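/- Let $X$ be an irreducible shift of finite type (SFT): a two-sided shift space over a finite alphabet, defined by finitely many forbidden words, such that for any two words $u,v$ of its language there is a nonempty word $w$ of its language with $uwv$ in the language. A factor map $\varpi:Y\to X$ of irreducible SFTs (a continuous shift-commuting surjection) is *unramified* of degree $d\ge 1$ if every fibre has exactly $d$ points. Let $\mathrm{Aut}(Y/X,\varpi)$ be the group of shift-commuting homeomorphisms $\varphi$ of $Y$ with $\varpi\circ\varphi=\varpi$; an unramified $\varpi$ is a *Galois factor* if $\#\mathrm{Aut}(Y/X,\varpi)=\deg\varpi$, and then this group is denoted $\mathrm{Gal}(Y/X,\varpi)$. For $x_0\in X$ let $\mathcal I(X,x_0)$ be the set of classes of pointed Galois factors $(Y,y_0,\varpi)$, where $Y$ is an irreducible SFT, $\varpi:Y\to X$ is a Galois factor and $\varpi(y_0)=x_0$, modulo pointed topological conjugacies over $X$. Write $[(Y_1,y_1,\varpi_1)]\le[(Y_2,y_2,\varpi_2)]$ if there is an unramified factor map $\alpha:Y_2\to Y_1$ with $\alpha(y_2)=y_1$ and $\varpi_2=\varpi_1\circ\alpha$. Fix representatives $(Y_i,y_i,\varpi_i)$,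 put $G_i=\mathrm{Gal}(Y_i/X,\varpi_i)$ with the discrete topology, and let $G_{X,x_0}$ be the group of all $(\varphi_i)\in\prod_i G_i$ such that $\varphi_i\circ\alpha=\alpha\circ\varphi_j$ for every $i\le j$ and every $\alpha:Y_j\to Y_i$ as above, with the topology induced by the product topology. Then the following hold. 1. For every $x_0\in X$, $(\mathcal I(X,x_0),\le)$ is a nonempty directed partially ordered set; all $G_i$ are finite; for $i\le j$ the map $\alpha=\alpha_{ij}:Y_j\to Y_i$ is unique; the rule $p_{ij}(\varphi)=\psi\iff\psi\circ\alpha_{ij}=\alpha_{ij}\circ\varphi$ defines surjective homomorphisms $p_{ij}:G_j\to G_i$ with $p_{ii}=\mathrm{id}$ and $p_{ij}\circ p_{jk}=p_{ik}$ for $i\le j\le k$; and $G_{X,x_0}=\{(\varphi_i)\mid \varphi_i=p_{ij}(\varphi_j)\text{ for all }i\le j\}=\varprojlim G_i$. This group is a compact, Hausdorff, totally disconnected topological group, and up to isomorphism of topological groups it does not depend on the choice of representatives. 2. For all $x_0,x_1\in X$, $G_{X,x_0}\cong G_{X,x_1}$ as topological groups. 3. For every $x_0\in X$ and every prime $p$,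 there is an isomorphism of $\mathbb F_p$-vector spaces from the continuous cohomology group $H^1(G_{X,x_0},\mathbb F_p)$ (trivial action, discrete coefficients) onto $\mathrm{Hom}_{\mathrm{cont}}(G_{X,x_0},\mathbb F_p)$, which sends the class of a homogeneous continuous $1$-cocycle $\sigma$ to $g\mapsto\sigma(1,g)$. 4. If $X'$ is an irreducible SFT topologically conjugate to $X$, then for all $x_0\in X$, $x_0'\in X'$ and all primes $p$, $G_{X,x_0}\cong G_{X',x_0'}$ as topological groups, and $H^1(G_{X,x_0},\mathbb F_p)\cong H^1(G_{X',x_0'},\mathbb F_p)$ and $\mathrm{Hom}_{\mathrm{cont}}(G_{X,x_0},\mathbb F_p)\cong\mathrm{Hom}_{\mathrm{cont}}(G_{X',x_0'},\mathbb F_p)$ as $\mathbb F_p$-vector spaces. -/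

import Mathlib

open SymbolicDynamics.FullShift

namespace SFTGalois

/-! ### Shift spaces, shifts of finite type, irreducibility -/

/-- The word `w` occurs in the bi-infinite sequence `x` at position `i`. -/
def OccursAt {A : Type} (w : List A) (x : ℤ → A) (i : ℤ) : Prop :=
  ∀ (k : ℕ) (hk : k < w.length), x (i + k) = w[k]

/-- The language of a shift space: the words occurring in its points. -/
def language {A : Type} [TopologicalSpace A] (X : Subshift A ℤ) : Set (List A) :=
  {w | ∃ x ∈ X.carrier, ∃ i : ℤ, OccursAt w x i}

/-- `X` is a shift of finite type: it is given by a finite set of forbidden words. -/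
def IsSFT {A : Type} [TopologicalSpace A] (X : Subshift A ℤ) : Prop :=
  ∃ F : Set (List A), F.Finite ∧ X.carrier = {x | ∀ w ∈ F, ∀ i : ℤ, ¬ OccursAt w x i}

/-- `X` is irreducible: any two words `u`, `v` of its language can be joined as `uwv`
with a nonempty word `w`. -/
def IsIrreducible {A : Type} [TopologicalSpace A] (X : Subshift A ℤ) : Prop :=
  ∀ u ∈ language X, ∀ v ∈ language X, ∃ w ∈ language X, w ≠ [] ∧ u ++ w ++ v ∈ language X

/-- The shift map `σ_X : X → X`. -/
def shiftMap {A : Type} [TopologicalSpace A] (X : Subshift A ℤ) (x : X.carrier) : X.carrier :=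
  ⟨shift (1 : ℤ) x.1, X.mapsTo 1 x.2⟩

/-! ### Factor maps, degrees, automorphisms, conjugacies -/

section maps

variable {A B : Type} [TopologicalSpace A] [TopologicalSpace B]

/-- A map between shift spaces commutes with the shift. -/
def ShiftCommuting {Y : Subshift B ℤ} {X : Subshift A ℤ} (f : Y.carrier → X.carrier) : Prop :=
  ∀ y, f (shiftMap Y y) = shiftMap X (f y)

/-- Factor maps: continuous shift-commuting surjections. -/
def IsFactorMap {Y : Subshift B ℤ} {X : Subshift A ℤ} (f : Y.carrier → X.carrier) : Prop :=
  Continuous f ∧ ShiftCommuting f ∧ Function.Surjective f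

/-- `f` is an unramified factor map of degree `d`: every fibre has exactly `d ≥ 1` points. -/
def IsUnramifiedOfDegree {Y : Subshift B ℤ} {X : Subshift A ℤ} (f : Y.carrier → X.carrier)
    (d : ℕ) : Prop :=
  IsFactorMap f ∧ 1 ≤ d ∧ ∀ x, (f ⁻¹' {x}).ncard = d

/-- Unramified factor maps. -/
def IsUnramified {Y : Subshift B ℤ} {X : Subshift A ℤ} (f : Y.carrier → X.carrier) : Prop :=
  ∃ d, IsUnramifiedOfDegree f d

/-- `X` and `Y` are topologically conjugate. -/
def Conjugate (Y : Subshift B ℤ) (X : Subshift A ℤ) : Prop :=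
  ∃ f : Y.carrier ≃ₜ X.carrier, ShiftCommuting f

/-- `Aut(Y)`, the group of shift-commuting homeomorphisms of `Y`. -/
def Aut (Y : Subshift B ℤ) : Subgroup (Y.carrier ≃ₜ Y.carrier) where
  carrier := {φ | ShiftCommuting φ}
  mul_mem' {φ ψ} hφ hψ y := by
    change φ (ψ (shiftMap Y y)) = shiftMap Y (φ (ψ y))
    rw [hψ y, hφ (ψ y)]
  one_mem' _ := rfl
  inv_mem' {φ} hφ y := by
    apply φ.injective
    rw [hφ]
    change φ (φ.symm _) = shiftMap Y (φ (φ.symm y))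
    simp

/-- `Aut(Y/X, ϖ) = {φ ∈ Aut(Y) | ϖ ∘ φ = ϖ}`. -/
def relAut {Y : Subshift B ℤ} {X : Subshift A ℤ} (ϖ : Y.carrier → X.carrier) :
    Subgroup (Y.carrier ≃ₜ Y.carrier) where
  carrier := {φ | φ ∈ Aut Y ∧ ∀ y, ϖ (φ y) = ϖ y}
  mul_mem' {φ ψ} hφ hψ :=
    ⟨mul_mem hφ.1 hψ.1, fun y => (hφ.2 (ψ y)).trans (hψ.2 y)⟩
  one_mem' := ⟨one_mem _, fun _ => rfl⟩
  inv_mem' {φ} hφ := ⟨inv_mem hφ.1, fun y => by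
    rw [← hφ.2 (φ⁻¹ y)]
    change ϖ (φ (φ.symm y)) = ϖ y
    simp⟩

/-- Galois factors: unramified factor maps with `#Aut(Y/X, ϖ) = deg ϖ`. -/
def IsGalois {Y : Subshift B ℤ} {X : Subshift A ℤ} (ϖ : Y.carrier → X.carrier) : Prop :=
  ∃ d, IsUnramifiedOfDegree ϖ d ∧ Nat.card (relAut ϖ) = d

end maps

/-! ### Pointed Galois factors and the absolute Galois group -/

section pointed

variable {A : Type} [TopologicalSpace A]

/-- A pointed Galois factor `(Y, y₀, ϖ)` over the pointed shift space `(X, x₀)`.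
The alphabet of `Y` is taken to be `{0, …, n - 1}`; as every finite alphabet can be relabelled
in this way, all conjugacy classes are represented. -/
structure PointedGaloisFactor (X : Subshift A ℤ) (x₀ : X.carrier) : Type where
  /-- the size of the alphabet of `Y` -/
  alphabetSize : ℕ
  /-- the shift space `Y` -/
  Y : Subshift (Fin alphabetSize) ℤ
  isSFT : IsSFT Y
  isIrreducible : IsIrreducible Y
  /-- the base point of `Y` -/
  y₀ : Y.carrier
  /-- the factor map `ϖ` -/
  ϖ : Y.carrier → X.carrier
  isGalois : IsGalois ϖ
  map_base : ϖ y₀ = x₀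

variable {X : Subshift A ℤ} {x₀ : X.carrier}

/-- `Gal(Y/X, ϖ)`. -/
abbrev Gal (P : PointedGaloisFactor X x₀) : Type := relAut P.ϖ

/-- Galois groups of Galois factors carry the discrete topology. -/
instance (P : PointedGaloisFactor X x₀) : TopologicalSpace (Gal P) := ⊥

instance (P : PointedGaloisFactor X x₀) : DiscreteTopology (Gal P) := ⟨rfl⟩

/-- `α : Q → P` is a pointed unramified factor map over `X`, i.e. `ϖ_Q = ϖ_P ∘ α`. -/
def IsTransition (P Q : PointedGaloisFactor X x₀) (α : Q.Y.carrier → P.Y.carrier) : Prop :=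
  IsUnramified α ∧ α Q.y₀ = P.y₀ ∧ ∀ y, P.ϖ (α y) = Q.ϖ y

/-- Two pointed Galois factors are identified if there is a pointed conjugacy over `X`. -/
instance conjugacySetoid (X : Subshift A ℤ) (x₀ : X.carrier) :
    Setoid (PointedGaloisFactor X x₀) where
  r P Q := ∃ γ : P.Y.carrier ≃ₜ Q.Y.carrier,
    ShiftCommuting γ ∧ γ P.y₀ = Q.y₀ ∧ ∀ y, Q.ϖ (γ y) = P.ϖ y
  iseqv :=
    { refl := fun P => ⟨Homeomorph.refl _, fun _ => rfl, rfl, fun _ => rfl⟩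
      symm := by
        rintro P Q ⟨γ, h1, h2, h3⟩
        refine ⟨γ.symm, fun y => ?_, ?_, fun y => ?_⟩
        · apply γ.injective
          rw [h1]
          simp
        · rw [← h2]
          simp
        · rw [← h3]
          simp
      trans := by
        rintro P Q R ⟨γ, h1, h2, h3⟩ ⟨δ, k1, k2, k3⟩
        refine ⟨γ.trans δ, fun y => ?_, ?_, fun y => ?_⟩
        · change δ (γ _) = shiftMap _ (δ (γ y))
          rw [h1, k1]
        · change δ (γ _) = _
          rw [h2, k2]
        · change R.ϖ (δ (γ y)) = _
          rw [k3, h3] }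

/-- `I(X, x₀)`, the set of conjugacy classes of pointed Galois factors over `(X, x₀)`. -/
def ConjClass (X : Subshift A ℤ) (x₀ : X.carrier) : Type := Quotient (conjugacySetoid X x₀)

/-- The conjugacy class of a pointed Galois factor. -/
def ConjClass.mk (P : PointedGaloisFactor X x₀) : ConjClass X x₀ := Quotient.mk _ P

/-- `[P] ≤ [Q]` if there is a pointed unramified factor map `Q → P` over `X`. -/
instance : LE (ConjClass X x₀) where
  le i j := ∃ P Q, ConjClass.mk P = i ∧ ConjClass.mk Q = j ∧ ∃ α, IsTransition P Q α

/-- A choice of a representative of each conjugacy class. -/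
def IsChoice (r : ConjClass X x₀ → PointedGaloisFactor X x₀) : Prop :=
  ∀ i, ConjClass.mk (r i) = i

/-- The fixed choice of representatives. -/
noncomputable def rep (i : ConjClass X x₀) : PointedGaloisFactor X x₀ := Quotient.out i

/-- The group of all families `(φ_i)` in `∏ Gal(Y_i/X)`, for a choice `r` of representatives,
that are compatible: `p_α(φ_j) = φ_i` for every transition map `α : Y_j → Y_i`. Here
`p_α(φ)` is the element `ψ` of `Gal(Y_i/X)` determined by `ψ ∘ α = α ∘ φ`. -/
def limitGroup (r : ConjClass X x₀ → PointedGaloisFactor X x₀) : Subgroup (∀ i, Gal (r i)) where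
  carrier := {g | ∀ i j α, IsTransition (r i) (r j) α → ∀ y, (g i).1 (α y) = α ((g j).1 y)}
  mul_mem' {g h} hg hh i j α hα y := by
    change (g i).1 ((h i).1 (α y)) = α ((g j).1 ((h j).1 y))
    rw [hh i j α hα, hg i j α hα]
  one_mem' _ _ _ _ _ := rfl
  inv_mem' {g} hg i j α hα y := by
    apply (g i).1.injective
    rw [hg i j α hα]
    change (g i).1 ((g i).1.symm _) = α ((g j).1 ((g j).1.symm y))
    simp

/-- The absolute Galois group `G_{X, x₀}`, with the topology induced by the product topology. -/
abbrev AbsGal (X : Subshift A ℤ) (x₀ : X.carrier) : Type :=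
  limitGroup (X := X) (x₀ := x₀) rep

end pointed

/-! ### First cohomology with coefficients in `𝔽_p` -/

/-- The trivial module `𝔽_p`, with the discrete topology. -/
abbrev trivialModule (p : ℕ) (G : Type) [Group G] : TopRep.{0} (ZMod p) G :=
  TopRep.of (ContRepresentation.trivial (ZMod p) G (ZMod p))

/-- The continuous cohomology group `H¹(G, 𝔽_p)`. -/
noncomputable abbrev H1 (p : ℕ) (G : Type) [Group G] [TopologicalSpace G]
    [IsTopologicalGroup G] : TopModuleCat (ZMod p) :=
  continuousCohomology 1 (trivialModule p G)

/-- `Hom_cont(G, 𝔽_p)` as a vector space over `𝔽_p`. -/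
def HomCont (p : ℕ) (G : Type) [Group G] [TopologicalSpace G] :
    Submodule (ZMod p) C(G, ZMod p) where
  carrier := {χ | ∀ g h, χ (g * h) = χ g + χ h}
  add_mem' {χ ψ} hχ hψ g h := by
    simp only [ContinuousMap.add_apply]
    rw [hχ, hψ]
    abel
  zero_mem' _ _ := by simp
  smul_mem' c χ hχ g h := by
    simp only [ContinuousMap.smul_apply]
    rw [hχ, smul_add]

/-- The value `σ(1, g)` of a homogeneous continuous 1-cocycle `σ`. -/
noncomputable def cocycleValue {p : ℕ} {G : Type} [Group G] [TopologicalSpace G]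
    [IsTopologicalGroup G] (σ : ContinuousCohomology.cocycles (trivialModule p G) 1) (g : G) :
    ZMod p :=
  let s : C(G, C(G, ZMod p)) :=
    (((TopRep.homogeneousCochains (trivialModule p G)).iCycles 1).hom σ).1
  s 1 g

end SFTGalois

/-!
The theory of Galois factors of an irreducible shift of finite type `X` parallels that of finite
Galois coverings of a connected space, with "connected" replaced by "no proper nonempty clopen
shift-invariant subset", a property of every irreducible subshift.

Everything rests on the fact that an unramified factor map separates its fibres uniformly: distinct
points of one fibre already differ on a window of fixed radius (`IsUnramified.separated`). Baire's
theorem gives such a window over a nonempty open set of base points, and irreducibility together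
with the gluing property of shifts of finite type spreads it to all of `X`. Hence lifts are unique:
two maps over `X` that agree at one point agree on a clopen shift-invariant set, hence everywhere
(`IsMapOver.eq_of_apply_eq`). So deck transformations act freely on fibres, and a factor is Galois
exactly when they also act transitively (`isGalois_of_fibreTransitive`,
`IsGalois.fibreTransitive`). Uniqueness of the transition maps, antisymmetry of the order, and the
surjective homomorphisms between the Galois groups follow formally, once one knows that maps over
`X` between Galois factors are surjective, since their images are clopen (`IsMapOver.surjective`).

For directedness, two Galois factors are dominated by a component of their fibre product. The fibre
product is a shift of finite type on which pairs of deck transformations act transitively along the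
fibres. Periodic points are dense in `X`, hence also in the fibre product, and with dense periodic
points a minimal clopen shift-invariant set is irreducible (`HasMemory.isIrreducible`,
`exists_galois_component`).

Independence of the representatives, of the base point, and of `X` within its conjugacy class are
one statement (`nonempty_limitGroup_equiv_of_conjugacy`): an inverse limit of finite fibres provides
compatible base points over any given point, and moving the base points there matches the two
inverse systems.

For the trivial module, the zeroth differential on homogeneous cochains vanishes, so the first
cohomology is the space of 1-cocycles. A cocycle `σ` is invariant, so it is determined by
`g ↦ σ(1, g)`, and the cocycle condition says that this function is a homomorphism
(`exists_h1_equiv_homCont`).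
-/

namespace SFTGalois

/-! ### Windows, block codes and gluing -/

section windows

variable {A B : Type}

/-- Two bi-infinite sequences agree on the window `[-k, k]`. -/
def Agree (k : ℕ) (x y : ℤ → A) : Prop :=
  ∀ t : ℤ, -k ≤ t → t ≤ k → x t = y t

lemma Agree.symm {k : ℕ} {x y : ℤ → A} (h : Agree k x y) : Agree k y x :=
  fun t h1 h2 => (h t h1 h2).symm

lemma Agree.trans {k : ℕ} {x y z : ℤ → A} (h : Agree k x y) (h' : Agree k y z) : Agree k x z :=
  fun t h1 h2 => (h t h1 h2).trans (h' t h1 h2)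

lemma Agree.mono {k l : ℕ} {x y : ℤ → A} (h : Agree l x y) (hkl : k ≤ l) : Agree k x y :=
  fun t h1 h2 => h t (by omega) (by omega)

lemma occursAt_append {u v : List A} {x : ℤ → A} {i : ℤ} :
    OccursAt (u ++ v) x i ↔ OccursAt u x i ∧ OccursAt v x (i + u.length) := by
  constructor
  · intro h
    refine ⟨fun k hk => ?_, fun k hk => ?_⟩
    · have := h k (by simp; omega)
      rwa [List.getElem_append_left hk] at this
    · have := h (u.length + k) (by simp; omega)
      rw [List.getElem_append_right (by omega)] at this
      simp only [Nat.add_sub_cancel_left] at this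
      rw [← this]
      congr 1
      push_cast
      ring
  · rintro ⟨h1, h2⟩ k hk
    by_cases hku : k < u.length
    · rw [List.getElem_append_left hku]
      exact h1 k hku
    · rw [List.getElem_append_right (by omega)]
      have := h2 (k - u.length) (by simp at hk; omega)
      rw [← this]
      congr 1
      omega

/-- The word of length `n` read off the sequence `x` from position `i` on. -/
def wordAt (x : ℤ → A) (i : ℤ) (n : ℕ) : List A := List.ofFn fun k : Fin n => x (i + k)

lemma length_wordAt (x : ℤ → A) (i : ℤ) (n : ℕ) : (wordAt x i n).length = n := by
  simp [wordAt]

lemma occursAt_wordAt {x y : ℤ → A} {i j : ℤ} {n : ℕ} :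
    OccursAt (wordAt x i n) y j ↔ ∀ k : ℕ, k < n → y (j + k) = x (i + k) := by
  simp [OccursAt, wordAt]

/-- The sequence that follows `a` on the non-positive and `b` on the positive coordinates. -/
def glue (a b : ℤ → A) : ℤ → A := fun i => if i ≤ 0 then a i else b i

lemma glue_of_nonpos {a b : ℤ → A} {i : ℤ} (h : i ≤ 0) : glue a b i = a i := if_pos h

lemma glue_of_pos {a b : ℤ → A} {i : ℤ} (h : 0 < i) : glue a b i = b i := if_neg (by omega)

lemma glue_left {a b : ℤ → A} {m : ℕ} (h : Agree m a b) {i : ℤ} (hi : i ≤ m) :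
    glue a b i = a i := by
  by_cases h0 : i ≤ 0
  · exact glue_of_nonpos h0
  · rw [glue_of_pos (by omega), h i (by omega) hi]

lemma glue_right {a b : ℤ → A} {m : ℕ} (h : Agree m a b) {i : ℤ} (hi : -m ≤ i) :
    glue a b i = b i := by
  by_cases h0 : i ≤ 0
  · rw [glue_of_nonpos h0, h i hi (by omega)]
  · exact glue_of_pos (by omega)

variable [TopologicalSpace A] [TopologicalSpace B]

/-- Membership in `X` is decided by the windows of radius `m`: a sequence all of whose windows
occur in `X` belongs to `X`. -/
def HasMemory (X : Subshift A ℤ) (m : ℕ) : Prop :=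
  ∀ x : ℤ → A, (∀ i : ℤ, ∃ y ∈ X.carrier, Agree m (shift i x) y) → x ∈ X.carrier

lemma IsSFT.exists_hasMemory {X : Subshift A ℤ} (h : IsSFT X) : ∃ m, HasMemory X m := by
  obtain ⟨F, hF, hX⟩ := h
  obtain ⟨m, hm⟩ := (hF.image List.length).bddAbove
  refine ⟨m, fun x hx => ?_⟩
  rw [hX]
  intro w hw i hocc
  obtain ⟨y, hy, hxy⟩ := hx i
  rw [hX] at hy
  refine hy w hw 0 fun k hk => ?_
  have hlen : w.length ≤ m := hm (Set.mem_image_of_mem _ hw)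
  rw [zero_add, ← hxy k (by omega) (by omega), shift_apply]
  exact hocc k hk

lemma HasMemory.isSFT [Finite A] {X : Subshift A ℤ} {m : ℕ} (h : HasMemory X m) : IsSFT X := by
  refine ⟨{w | w.length = 2 * m + 1 ∧ w ∉ language X},
    (List.finite_length_eq A (2 * m + 1)).subset fun w hw => hw.1, ?_⟩
  apply Set.Subset.antisymm
  · intro x hx w hw i hocc
    exact hw.2 ⟨x, hx, i, hocc⟩
  · intro x hx
    apply h
    intro i
    have h1 : wordAt x (i - m) (2 * m + 1) ∈ language X := by
      by_contra hcon
      exact hx _ ⟨length_wordAt _ _ _, hcon⟩ (i - m) (occursAt_wordAt.2 fun k _ => rfl)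
    obtain ⟨y, hy, j, hj⟩ := h1
    rw [occursAt_wordAt] at hj
    refine ⟨shift (j + m) y, X.mapsTo _ hy, fun t h1 h2 => ?_⟩
    have := hj (t + m).toNat (by omega)
    rw [shift_apply, shift_apply]
    rw [show j + m + t = j + ((t + m).toNat : ℤ) by omega, this]
    congr 1
    omega

lemma HasMemory.glue_mem {X : Subshift A ℤ} {m : ℕ} (hX : HasMemory X m) {a b : ℤ → A}
    (ha : a ∈ X.carrier) (hb : b ∈ X.carrier) (hab : Agree m a b) : glue a b ∈ X.carrier := by
  apply hX
  intro i
  by_cases hi : i ≤ 0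
  · exact ⟨shift i a, X.mapsTo _ ha, fun t _ h2 => glue_left hab (by omega)⟩
  · exact ⟨shift i b, X.mapsTo _ hb, fun t h1 _ => glue_right hab (by omega)⟩

/-- The window of `y` of radius `k` can be reached in `X` from that of `x`: both occur in a point
of `X`, without overlap and in this order. -/
def Reach (X : Subshift A ℤ) (k : ℕ) (x y : ℤ → A) : Prop :=
  ∃ q ∈ X.carrier, ∃ j : ℤ, 2 * k + 1 ≤ j ∧ Agree k q x ∧ Agree k (shift j q) y

lemma Reach.trans {X : Subshift A ℤ} {m k : ℕ} (hX : HasMemory X m) (hmk : m ≤ k)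
    {x y z : ℤ → A} (h1 : Reach X k x y) (h2 : Reach X k y z) : Reach X k x z := by
  obtain ⟨q, hq, i, hi, hqx, hqy⟩ := h1
  obtain ⟨q', hq', j, hj, hqy', hqz⟩ := h2
  have hag : Agree k (shift i q) q' := hqy.trans hqy'.symm
  refine ⟨shift (-i) (glue (shift i q) q'),
    X.mapsTo _ (hX.glue_mem (X.mapsTo _ hq) hq' (hag.mono hmk)), i + j, by omega, ?_, ?_⟩
  · intro t h1 h2
    rw [shift_apply, glue_of_nonpos (by omega), shift_apply, ← hqx t h1 h2]
    congr 1
    ring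
  · intro t h1 h2
    rw [shift_apply, shift_apply, ← hqz t h1 h2, shift_apply]
    rw [show -i + (i + j + t) = j + t by ring, glue_of_pos (by omega)]

lemma IsIrreducible.reach {X : Subshift A ℤ} (h : IsIrreducible X) (k : ℕ) {x y : ℤ → A}
    (hx : x ∈ X.carrier) (hy : y ∈ X.carrier) : Reach X k x y := by
  have key : ∀ z ∈ X.carrier, wordAt z (-k) (2 * k + 1) ∈ language X := fun z hz =>
    ⟨z, hz, -k, occursAt_wordAt.2 fun _ _ => rfl⟩
  obtain ⟨w, -, -, q, hq, i, hi⟩ := h _ (key x hx) _ (key y hy)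
  rw [occursAt_append, occursAt_append, occursAt_wordAt, occursAt_wordAt] at hi
  obtain ⟨⟨h1, -⟩, h2⟩ := hi
  simp only [List.length_append, length_wordAt] at h2
  refine ⟨shift (i + k) q, X.mapsTo _ hq, 2 * k + 1 + w.length, by omega, ?_, ?_⟩
  · intro t ht1 ht2
    have := h1 (t + k).toNat (by omega)
    rw [show -(k : ℤ) + ((t + k).toNat : ℤ) = t by omega] at this
    rw [← this, shift_apply]
    congr 1
    omega
  · intro t ht1 ht2
    have := h2 (t + k).toNat (by omega)
    rw [show -(k : ℤ) + ((t + k).toNat : ℤ) = t by omega] at this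
    rw [← this, shift_apply, shift_apply]
    congr 1
    push_cast
    omega

lemma isIrreducible_of_reach {X : Subshift A ℤ}
    (h : ∀ k, ∀ x ∈ X.carrier, ∀ y ∈ X.carrier, Reach X k x y) : IsIrreducible X := by
  rintro u ⟨x, hx, i, hu⟩ v ⟨y, hy, i', hv⟩
  obtain ⟨q, hq, j, hj, hqx, hqy⟩ := h (u.length + v.length) _ (X.mapsTo i hx) _ (X.mapsTo i' hy)
  have hw : OccursAt (u ++ wordAt q u.length (j - u.length).toNat ++ v) q 0 := by
    rw [occursAt_append, occursAt_append, occursAt_wordAt]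
    refine ⟨⟨fun k hk => ?_, fun k _ => by rw [zero_add]⟩, fun k hk => ?_⟩
    · rw [zero_add, hqx k (by omega) (by omega)]
      exact hu k hk
    · rw [← hv k hk]
      have := hqy k (by omega) (by omega)
      rw [shift_apply, shift_apply] at this
      rw [← this]
      congr 1
      simp only [List.length_append, length_wordAt]
      push_cast at hj ⊢
      omega
  refine ⟨_, ⟨q, hq, u.length, occursAt_wordAt.2 fun _ _ => rfl⟩, ?_, q, hq, 0, hw⟩
  intro h0
  have := congrArg List.length h0
  rw [length_wordAt] at this
  simp at this
  push_cast at hj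
  omega

/-- Periodic points are dense in `X`. -/
def DensePeriodic (X : Subshift A ℤ) : Prop :=
  ∀ k : ℕ, ∀ x ∈ X.carrier, ∃ p ∈ X.carrier, Agree k p x ∧ ∃ n : ℕ, 0 < n ∧ shift (n : ℤ) p = p

/-- Closing up a return of a window of `x` to itself gives a periodic point near `x`. -/
lemma IsIrreducible.densePeriodic {X : Subshift A ℤ} (h : IsIrreducible X) (hS : IsSFT X) :
    DensePeriodic X := by
  obtain ⟨m, hm⟩ := hS.exists_hasMemory
  intro k x hx
  obtain ⟨q, hq, j, hj, h1, h2⟩ := h.reach (k + m) hx hx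
  have hj0 : 0 < j := by omega
  have hsh : ∀ t : ℤ, -(k + m : ℕ) ≤ t → t ≤ (k + m : ℕ) → q (j + t) = q t := fun t ht ht' => by
    have := h2 t ht ht'
    rw [shift_apply] at this
    rw [this, h1 t ht ht']
  have hper : ∀ i t : ℤ, -(k + m : ℕ) ≤ t → t ≤ (k + m : ℕ) →
      q ((i + t) % j) = q (i % j + t) := by
    intro i t ht ht'
    have hi0 := Int.emod_nonneg i hj0.ne'
    have hi1 := Int.emod_lt_of_pos i hj0
    have hmod : (i + t) % j = (i % j + t) % j := by simp
    rw [hmod]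
    by_cases c1 : i % j + t < 0
    · rw [← Int.add_emod_right, Int.emod_eq_of_lt (by omega) (by omega), add_comm,
        hsh _ (by omega) (by omega)]
    · by_cases c2 : i % j + t < j
      · rw [Int.emod_eq_of_lt (by omega) c2]
      · rw [← Int.sub_emod_right, Int.emod_eq_of_lt (by omega) (by omega),
          ← hsh _ (by omega) (by omega)]
        congr 1
        ring
  refine ⟨fun i => q (i % j), hm _ fun i => ⟨shift (i % j) q, X.mapsTo _ hq, fun t ht ht' => ?_⟩,
    fun t ht ht' => ?_, j.toNat, by omega, ?_⟩
  · exact hper i t (by omega) (by omega)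
  · have := hper 0 t (by omega) (by omega)
    simp only [zero_add, Int.zero_emod] at this
    exact this.trans (h1 t (by omega) (by omega))
  · funext i
    rw [shift_apply, Int.toNat_of_nonneg hj0.le]
    simp

end windows

/-! ### The topology of subshifts -/

section topology

variable {A B C : Type} [TopologicalSpace A] [TopologicalSpace B] [TopologicalSpace C]

instance [Finite A] (X : Subshift A ℤ) : CompactSpace X.carrier :=
  isCompact_iff_compactSpace.1 X.isClosed.isCompact

/-- The shift by an arbitrary integer, as a self-map of a subshift. -/
def shiftInt (X : Subshift A ℤ) (n : ℤ) (x : X.carrier) : X.carrier :=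
  ⟨shift n x.1, X.mapsTo n x.2⟩

lemma shiftInt_apply (X : Subshift A ℤ) (n : ℤ) (x : X.carrier) (i : ℤ) :
    (shiftInt X n x).1 i = x.1 (n + i) := rfl

lemma shiftInt_shiftInt (X : Subshift A ℤ) (m n : ℤ) (x : X.carrier) :
    shiftInt X m (shiftInt X n x) = shiftInt X (m + n) x := by
  apply Subtype.ext
  funext i
  exact congrArg x.1 (by ring)

lemma shiftInt_zero (X : Subshift A ℤ) (x : X.carrier) : shiftInt X 0 x = x := by
  apply Subtype.ext
  funext i
  simp [shiftInt_apply]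

lemma shiftMap_eq (X : Subshift A ℤ) (x : X.carrier) : shiftMap X x = shiftInt X 1 x := rfl

lemma shiftInt_injective (X : Subshift A ℤ) (n : ℤ) : Function.Injective (shiftInt X n) := by
  intro x y h
  have := congrArg (shiftInt X (-n)) h
  simpa [shiftInt_shiftInt, shiftInt_zero] using this

lemma ShiftCommuting.shiftInt {Y : Subshift B ℤ} {X : Subshift A ℤ} {f : Y.carrier → X.carrier}
    (hf : ShiftCommuting f) (n : ℤ) (y : Y.carrier) :
    f (shiftInt Y n y) = SFTGalois.shiftInt X n (f y) := by
  have hnat : ∀ (n : ℕ) y, f (SFTGalois.shiftInt Y n y) = SFTGalois.shiftInt X n (f y) := by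
    intro n
    induction n with
    | zero => intro y; simp [shiftInt_zero]
    | succ n ih =>
      intro y
      have := hf (SFTGalois.shiftInt Y n y)
      rw [shiftMap_eq, shiftMap_eq, shiftInt_shiftInt, ih, shiftInt_shiftInt] at this
      rw [Nat.cast_succ, add_comm (n : ℤ) 1]
      exact this
  obtain ⟨k, rfl | rfl⟩ := n.eq_nat_or_neg
  · exact hnat k y
  · apply shiftInt_injective X k
    rw [← hnat, shiftInt_shiftInt, shiftInt_shiftInt]
    simp [shiftInt_zero]

lemma ShiftCommuting.comp {Z : Subshift C ℤ} {Y : Subshift B ℤ} {X : Subshift A ℤ}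
    {g : Y.carrier → X.carrier} {f : Z.carrier → Y.carrier} (hg : ShiftCommuting g)
    (hf : ShiftCommuting f) : ShiftCommuting (g ∘ f) := fun z => by
  rw [Function.comp_apply, hf, hg, Function.comp_apply]

lemma ShiftCommuting.homeomorph_symm {Y : Subshift B ℤ} {X : Subshift A ℤ}
    {f : Y.carrier ≃ₜ X.carrier} (hf : ShiftCommuting f) : ShiftCommuting f.symm := fun x => by
  apply f.injective
  rw [hf]
  simp

lemma isOpen_setOf_agree [DiscreteTopology A] (X : Subshift A ℤ) (k : ℕ) (x : ℤ → A) :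
    IsOpen {y : X.carrier | Agree k y.1 x} := by
  have : {y : X.carrier | Agree k y.1 x} =
      ⋂ t ∈ Finset.Icc (-(k : ℤ)) k, {y : X.carrier | y.1 t = x t} := by
    ext y
    simp [Agree]
  rw [this]
  refine isOpen_biInter_finset fun t _ => ?_
  exact (isOpen_discrete {x t}).preimage (f := fun y : X.carrier => y.1 t)
    ((continuous_apply t).comp continuous_subtype_val)

/-- The windows around a point form a basis of its neighbourhoods. -/
lemma exists_agree_subset {X : Subshift A ℤ} {U : Set X.carrier} (hU : IsOpen U) {x : X.carrier}
    (hx : x ∈ U) : ∃ k : ℕ, ∀ y : X.carrier, Agree k y.1 x.1 → y ∈ U := by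
  obtain ⟨V, hV, rfl⟩ := isOpen_induced_iff.1 hU
  obtain ⟨I, u, hu, hIV⟩ := isOpen_pi_iff.1 hV x.1 hx
  obtain ⟨k, hk⟩ := (I.image Int.natAbs).bddAbove
  refine ⟨k, fun y hy => hIV fun i hi => ?_⟩
  have : i.natAbs ≤ k := hk (Finset.mem_coe.2 (Finset.mem_image_of_mem _ hi))
  rw [hy i (by omega) (by omega)]
  exact (hu i hi).2

/-- A continuous map from a subshift to a discrete space depends on one window. -/
lemma exists_window [Finite A] [DiscreteTopology A] (X : Subshift A ℤ) {S : Type*}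
    [TopologicalSpace S] [DiscreteTopology S] {f : X.carrier → S} (hf : Continuous f) :
    ∃ r : ℕ, ∀ x y : X.carrier, Agree r x.1 y.1 → f x = f y := by
  let U : ℕ → Set X.carrier := fun r => {x | ∀ y : X.carrier, Agree r x.1 y.1 → f x = f y}
  have hUo : ∀ r, IsOpen (U r) := fun r => by
    rw [isOpen_iff_forall_mem_open]
    intro x hx
    refine ⟨_, fun z hz => ?_, isOpen_setOf_agree X r x.1, fun t _ _ => rfl⟩
    intro y hzy
    rw [← hx y (hz.symm.trans hzy), ← hx z hz.symm]
  have hcov : (Set.univ : Set X.carrier) ⊆ ⋃ r, U r := by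
    intro x _
    obtain ⟨k, hk⟩ := exists_agree_subset ((isOpen_discrete {f x}).preimage hf)
      (x := x) rfl
    exact Set.mem_iUnion.2 ⟨k, fun y hy => (hk y hy.symm).symm⟩
  obtain ⟨r, hr⟩ := isCompact_univ.elim_directed_cover U hUo hcov
    (Monotone.directed_le fun a b hab x hx y hy => hx y (hy.mono hab))
  exact ⟨r, fun x y => hr (Set.mem_univ x) y⟩

/-- A continuous shift-commuting map is a block code. -/
lemma ShiftCommuting.exists_block [Finite B] [DiscreteTopology A] [DiscreteTopology B]
    {Y : Subshift B ℤ} {X : Subshift A ℤ} {f : Y.carrier → X.carrier}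
    (hc : Continuous f) (hf : ShiftCommuting f) :
    ∃ r : ℕ, ∀ (y y' : Y.carrier) (i : ℤ), (∀ t, i - r ≤ t → t ≤ i + r → y.1 t = y'.1 t) →
      (f y).1 i = (f y').1 i := by
  obtain ⟨r, hr⟩ := exists_window Y (f := fun y => (f y).1 0)
    ((continuous_apply 0).comp (continuous_subtype_val.comp hc))
  refine ⟨r, fun y y' i h => ?_⟩
  have := hr (SFTGalois.shiftInt Y i y) (SFTGalois.shiftInt Y i y') fun t h1 h2 => by
    rw [shiftInt_apply, shiftInt_apply, h _ (by omega) (by omega)]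
  simp only [hf.shiftInt, shiftInt_apply, add_zero] at this
  exact this

/-! ### Clopen shift-invariant sets -/

/-- Shift-invariant sets `D`, in the strong sense `σ⁻¹ D = D`. -/
def Invariant (X : Subshift A ℤ) (D : Set X.carrier) : Prop :=
  ∀ x, shiftMap X x ∈ D ↔ x ∈ D

lemma Invariant.shiftInt {X : Subshift A ℤ} {D : Set X.carrier} (hD : Invariant X D) (n : ℤ)
    (x : X.carrier) : SFTGalois.shiftInt X n x ∈ D ↔ x ∈ D := by
  have hnat : ∀ (n : ℕ) x, SFTGalois.shiftInt X n x ∈ D ↔ x ∈ D := by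
    intro n
    induction n with
    | zero => intro y; simp [shiftInt_zero]
    | succ n ih =>
      intro y
      rw [Nat.cast_succ, add_comm (n : ℤ) 1, ← shiftInt_shiftInt, ← shiftMap_eq, hD, ih]
  obtain ⟨k, rfl | rfl⟩ := n.eq_nat_or_neg
  · exact hnat k x
  · rw [← hnat k, shiftInt_shiftInt]
    simp [shiftInt_zero]

lemma IsIrreducible.eq_univ_of_isClopen {X : Subshift A ℤ} (h : IsIrreducible X)
    {D : Set X.carrier} (hD : IsClopen D) (hinv : Invariant X D) (hne : D.Nonempty) :
    D = Set.univ := by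
  obtain ⟨x, hx⟩ := hne
  by_contra hcon
  obtain ⟨y, hy⟩ := (Set.ne_univ_iff_exists_notMem D).1 hcon
  obtain ⟨k, hk⟩ := exists_agree_subset hD.isOpen hx
  obtain ⟨l, hl⟩ := exists_agree_subset hD.compl.isOpen hy
  obtain ⟨q, hq, j, -, h1, h2⟩ := h.reach (max k l) x.2 y.2
  have h3 : (⟨q, hq⟩ : X.carrier) ∈ D := hk _ (h1.mono (le_max_left _ _))
  have h4 : SFTGalois.shiftInt X j ⟨q, hq⟩ ∈ Dᶜ := hl _ (h2.mono (le_max_right _ _))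
  exact h4 ((hinv.shiftInt j _).2 h3)

/-- For shifts of finite type with dense periodic points, irreducibility follows from the absence
of proper clopen shift-invariant subsets: the set of points whose window can be reached from a
given window is such a subset. -/
lemma HasMemory.isIrreducible [DiscreteTopology A] {X : Subshift A ℤ} {m : ℕ} (hX : HasMemory X m)
    (hper : DensePeriodic X)
    (hconn : ∀ D : Set X.carrier, IsClopen D → Invariant X D → D.Nonempty → D = Set.univ) :
    IsIrreducible X := by
  have hshift : ∀ k, ∀ z ∈ X.carrier, ∀ i : ℤ, Reach X k z (shift i z) := by
    intro k z hz i
    obtain ⟨p, hp, hpz, n, hn, hpn⟩ := hper (k + i.natAbs) z hz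
    -- adding a large multiple of the period to `i` makes the two windows disjoint
    have hmul : ∀ N : ℕ, ∀ t, p (N * n + t) = p t := by
      intro N
      induction N with
      | zero => intro t; simp
      | succ N ih =>
        intro t
        have := congrFun hpn (N * n + t)
        rw [shift_apply, ih] at this
        rw [← this]
        congr 1
        push_cast
        ring
    have hN : 2 * k + 1 + i.natAbs ≤ (2 * k + 1 + i.natAbs) * n := Nat.le_mul_of_pos_right _ hn
    refine ⟨p, hp, ((2 * k + 1 + i.natAbs : ℕ) : ℤ) * n + i, ?_, hpz.mono (by omega), ?_⟩
    · zify at hN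
      push_cast
      have := neg_abs_le i
      linarith
    · intro t h1 h2
      rw [shift_apply, shift_apply, add_assoc, hmul]
      have h3 := neg_abs_le i
      have h4 := le_abs_self i
      exact hpz _ (by push_cast; omega) (by push_cast; omega)
  have hbig : ∀ k, m ≤ k → ∀ x ∈ X.carrier, ∀ y ∈ X.carrier, Reach X k x y := by
    intro k hk x hx y hy
    have hloc : ∀ z z' : ℤ → A, Agree k z z' → Reach X k x z → Reach X k x z' := by
      rintro z z' hzz ⟨q, hq, j, hj, h1, h2⟩
      exact ⟨q, hq, j, hj, h1, h2.trans hzz⟩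
    have := hconn {z | Reach X k x z.1} ?_ ?_ ?_
    · exact this.ge (Set.mem_univ (⟨y, hy⟩ : X.carrier))
    · constructor
      · rw [← isOpen_compl_iff, isOpen_iff_forall_mem_open]
        exact fun z hz => ⟨_, fun z' hz' h => hz (hloc _ _ hz' h), isOpen_setOf_agree X k z.1,
          fun t _ _ => rfl⟩
      · rw [isOpen_iff_forall_mem_open]
        exact fun z hz => ⟨_, fun z' hz' => hloc _ _ hz'.symm hz, isOpen_setOf_agree X k z.1,
          fun t _ _ => rfl⟩
    · intro z
      constructor
      · intro h
        have h2 := hshift k _ (shiftMap X z).2 (-1)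
        have h3 : shift (-1 : ℤ) (shiftMap X z).1 = z.1 := by
          funext i
          simp [shiftMap]
        rw [h3] at h2
        exact Reach.trans hX hk h h2
      · intro h
        exact Reach.trans hX hk h (hshift k _ z.2 1)
    · refine ⟨⟨x, hx⟩, ?_⟩
      have := hshift k x hx 0
      rwa [shift_zero] at this
  refine isIrreducible_of_reach fun k x hx y hy => ?_
  obtain ⟨q, hq, j, hj, h1, h2⟩ := hbig (k + m) (by omega) x hx y hy
  exact ⟨q, hq, j, by push_cast at hj; omega, h1.mono (by omega), h2.mono (by omega)⟩

end topology

/-! ### Unramified factor maps separate fibres uniformly -/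

section separated

variable {A B C : Type} [TopologicalSpace A] [TopologicalSpace B] [TopologicalSpace C]

/-- Distinct points of a fibre of `f` already differ on a window of fixed radius. -/
def Separated {Y : Subshift B ℤ} {X : Subshift A ℤ} (f : Y.carrier → X.carrier) : Prop :=
  ∃ k : ℕ, ∀ y y' : Y.carrier, f y = f y' → Agree k y.1 y'.1 → y = y'

/-- The restriction of the points of `Y` to the window `[-k, k]`. -/
def restrictWindow (Y : Subshift B ℤ) (k : ℕ) (y : Y.carrier) : Set.Icc (-k : ℤ) k → B :=
  fun t => y.1 t

lemma restrictWindow_eq_iff {Y : Subshift B ℤ} {k : ℕ} {y y' : Y.carrier} :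
    restrictWindow Y k y = restrictWindow Y k y' ↔ Agree k y.1 y'.1 :=
  ⟨fun h t h1 h2 => congrFun h ⟨t, h1, h2⟩, fun h => funext fun t => h t t.2.1 t.2.2⟩

lemma continuous_restrictWindow (Y : Subshift B ℤ) (k : ℕ) : Continuous (restrictWindow Y k) :=
  continuous_pi fun t => (continuous_apply (t : ℤ)).comp continuous_subtype_val

lemma Separated.finite_fibre [Finite B] {Y : Subshift B ℤ} {X : Subshift A ℤ}
    {f : Y.carrier → X.carrier} (hf : Separated f) (x : X.carrier) : (f ⁻¹' {x}).Finite := by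
  obtain ⟨k, hk⟩ := hf
  refine Set.Finite.of_injOn (f := restrictWindow Y k) (t := Set.univ) (fun _ _ => Set.mem_univ _)
    ?_ Set.finite_univ
  intro y hy y' hy' h
  exact hk y y' (hy.trans hy'.symm) (restrictWindow_eq_iff.1 h)

variable [Finite A] [Finite B] [DiscreteTopology A] [DiscreteTopology B]

/-- If all fibres of `f` have `d` points, the points over which the window `[-k, k]` separates the
fibre form a closed set: they are those whose fibre realizes at least `d` windows. -/
lemma IsUnramifiedOfDegree.isClosed_separated {Y : Subshift B ℤ} {X : Subshift A ℤ}
    {f : Y.carrier → X.carrier} {d : ℕ} (hf : IsUnramifiedOfDegree f d) (k : ℕ) :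
    IsClosed {x | Set.InjOn (restrictWindow Y k) (f ⁻¹' {x})} := by
  have hfin : ∀ x, (f ⁻¹' {x}).Finite := fun x =>
    Set.finite_of_ncard_pos (by rw [hf.2.2 x]; exact hf.2.1)
  have heq : {x | Set.InjOn (restrictWindow Y k) (f ⁻¹' {x})} =
      ⋃ S : {S : Finset (Set.Icc (-k : ℤ) k → B) // S.card = d},
        ⋂ w ∈ S.1, f '' (restrictWindow Y k ⁻¹' {w}) := by
    ext x
    simp only [Set.mem_ofPred_eq, Set.mem_iUnion, Set.mem_iInter]
    constructor
    · intro h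
      refine ⟨⟨((hfin x).image (restrictWindow Y k)).toFinset, ?_⟩, ?_⟩
      · rw [← Set.ncard_eq_toFinset_card, h.ncard_image, hf.2.2 x]
      · intro w hw
        obtain ⟨y, hy, rfl⟩ := (Set.Finite.mem_toFinset _).1 hw
        exact ⟨y, rfl, hy⟩
    · rintro ⟨⟨S, hS⟩, h⟩
      rw [← Set.ncard_image_iff (hfin x)]
      apply le_antisymm (Set.ncard_image_le (hfin x))
      rw [hf.2.2 x, ← hS, ← Set.ncard_coe_finset]
      refine Set.ncard_le_ncard ?_ ((hfin x).image _)
      intro w hw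
      obtain ⟨y, hy, hyx⟩ := h w hw
      exact ⟨y, hyx, hy⟩
  rw [heq]
  refine isClosed_iUnion_of_finite fun S => isClosed_biInter fun w _ => ?_
  exact ((isClosed_singleton.preimage (continuous_restrictWindow Y k)).isCompact.image
    hf.1.1).isClosed

/-- By Baire's theorem some window separates the fibres over a nonempty open set of points. If two
points of a fibre agreed on a huge window but differed elsewhere, a word over that open set could
be glued in on the side opposite to their difference, and the fibre over the new point would
contradict the choice of the window. -/
theorem IsUnramified.separated {Y : Subshift B ℤ} {X : Subshift A ℤ}
    {f : Y.carrier → X.carrier} (hf : IsUnramified f) (hY : IsSFT Y) (hirr : IsIrreducible Y) :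
    Separated f := by
  obtain ⟨d, hd⟩ := hf
  rcases isEmpty_or_nonempty X.carrier with hX | hX
  · exact ⟨0, fun y => (hX.false (f y)).elim⟩
  have hfin : ∀ x, (f ⁻¹' {x}).Finite := fun x =>
    Set.finite_of_ncard_pos (by rw [hd.2.2 x]; exact hd.2.1)
  have hcov : ⋃ k, {x | Set.InjOn (restrictWindow Y k) (f ⁻¹' {x})} = Set.univ := by
    refine Set.eq_univ_of_forall fun x => Set.mem_iUnion.2 ?_
    have hpair : ∀ y y' : Y.carrier, ∃ k : ℕ, Agree k y.1 y'.1 → y = y' := by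
      intro y y'
      by_contra! hcon
      refine (hcon 0).2 (Subtype.ext (funext fun t => ?_))
      exact (hcon t.natAbs).1 t (by omega) (by omega)
    choose K hK using hpair
    obtain ⟨k, hk⟩ := (((hfin x).prod (hfin x)).image fun p => K p.1 p.2).bddAbove
    refine ⟨k, fun y hy y' hy' h => hK y y' ((restrictWindow_eq_iff.1 h).mono ?_)⟩
    exact hk ⟨(y, y'), ⟨hy, hy'⟩, rfl⟩
  obtain ⟨k, x₁, hx₁⟩ := nonempty_interior_of_iUnion_of_closed
    (fun k => hd.isClosed_separated k) hcov
  obtain ⟨p, rfl⟩ := hd.1.2.2 x₁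
  obtain ⟨l, hl⟩ := exists_agree_subset (isOpen_interior.preimage hd.1.1) (x := p) hx₁
  have hsep : ∀ y y' : Y.carrier, Agree l y.1 p.1 → f y = f y' → Agree k y.1 y'.1 → y = y' :=
    fun y y' h1 h2 h3 => interior_subset (hl y h1) rfl h2.symm (restrictWindow_eq_iff.2 h3)
  obtain ⟨m, hm⟩ := hY.exists_hasMemory
  obtain ⟨r, hr⟩ := hd.1.2.1.exists_block hd.1.1
  refine ⟨m + r + k + l, fun y y' hyy hag => ?_⟩
  generalize hL : m + r + k + l = L at hag
  by_contra hne
  obtain ⟨n, hn⟩ : ∃ n, y.1 n ≠ y'.1 n := by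
    by_contra! hcon
    exact hne (Subtype.ext (funext hcon))
  -- around each position the new points `z`, `z'` agree, or they follow `y`, `y'` respectively
  have himg : ∀ z z' : Y.carrier, (∀ i : ℤ, (∀ t, i - r ≤ t → t ≤ i + r → z.1 t = z'.1 t) ∨
      ((∀ t, i - r ≤ t → t ≤ i + r → z.1 t = y.1 t) ∧
        ∀ t, i - r ≤ t → t ≤ i + r → z'.1 t = y'.1 t)) → f z = f z' := by
    intro z z' h
    refine Subtype.ext (funext fun i => ?_)
    rcases h i with h | ⟨h1, h2⟩
    · exact hr _ _ i h
    · rw [hr _ _ i h1, hr _ _ i h2, hyy]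
  rcases lt_or_ge 0 n with hn0 | hn0
  · -- the difference is on the right: put the window of `p` far to the left
    obtain ⟨q, hq, j, hj, h1, h2⟩ := hirr.reach L p.2 y.2
    have hq' := Y.mapsTo j hq
    have h2' := h2.trans hag
    let z : Y.carrier := ⟨_, hm.glue_mem hq' y.2 (h2.mono (by omega))⟩
    let z' : Y.carrier := ⟨_, hm.glue_mem hq' y'.2 (h2'.mono (by omega))⟩
    have hzz : f z = f z' := himg z z' fun i => by
      by_cases hi : i + r ≤ L
      · exact .inl fun t _ _ => (glue_left h2 (by omega)).trans (glue_left h2' (by omega)).symm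
      · exact .inr ⟨fun t _ _ => glue_right h2 (by omega), fun t _ _ => glue_right h2' (by omega)⟩
    have := hsep (shiftInt Y (-j) z) (shiftInt Y (-j) z') (fun t ht ht' => ?_)
      (by rw [hd.1.2.1.shiftInt, hzz, hd.1.2.1.shiftInt]) (fun t ht ht' => ?_)
    · have := congrArg (fun y => y.1 n) (shiftInt_injective Y _ this)
      exact hn ((glue_of_pos hn0).symm.trans (this.trans (glue_of_pos hn0)))
    · rw [← h1 t (by omega) (by omega), shiftInt_apply]
      refine (glue_of_nonpos (by omega)).trans ?_
      rw [shift_apply]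
      exact congrArg q (by ring)
    · rw [shiftInt_apply, shiftInt_apply]
      exact (glue_of_nonpos (by omega)).trans (glue_of_nonpos (by omega)).symm
  · -- the difference is on the left: put the window of `p` far to the right
    obtain ⟨q, hq, j, hj, h1, h2⟩ := hirr.reach L y.2 p.2
    have h1' := h1.trans hag
    let z : Y.carrier := ⟨_, hm.glue_mem y.2 hq (h1.symm.mono (by omega))⟩
    let z' : Y.carrier := ⟨_, hm.glue_mem y'.2 hq (h1'.symm.mono (by omega))⟩
    have hzz : f z = f z' := himg z z' fun i => by
      by_cases hi : i + r ≤ L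
      · exact .inr ⟨fun t _ _ => glue_left h1.symm (by omega),
          fun t _ _ => glue_left h1'.symm (by omega)⟩
      · exact .inl fun t _ _ =>
          (glue_right h1.symm (by omega)).trans (glue_right h1'.symm (by omega)).symm
    have := hsep (shiftInt Y j z) (shiftInt Y j z') (fun t ht ht' => ?_)
      (by rw [hd.1.2.1.shiftInt, hzz, hd.1.2.1.shiftInt]) (fun t ht ht' => ?_)
    · have := congrArg (fun y => y.1 n) (shiftInt_injective Y _ this)
      exact hn ((glue_of_nonpos hn0).symm.trans (this.trans (glue_of_nonpos hn0)))
    · rw [← h2 t (by omega) (by omega), shiftInt_apply, shift_apply]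
      exact glue_of_pos (by omega)
    · rw [shiftInt_apply, shiftInt_apply]
      exact (glue_of_pos (by omega)).trans (glue_of_pos (by omega)).symm

end separated

/-! ### Deck transformations -/

section deck

variable {A B C : Type} [TopologicalSpace A] [TopologicalSpace B] [TopologicalSpace C]

/-- Continuous shift-commuting maps `α : Z → Y` over `X`, i.e. with `f ∘ α = g`. -/
def IsMapOver {Z : Subshift C ℤ} {Y : Subshift B ℤ} {X : Subshift A ℤ}
    (f : Y.carrier → X.carrier) (g : Z.carrier → X.carrier) (α : Z.carrier → Y.carrier) : Prop :=
  Continuous α ∧ ShiftCommuting α ∧ ∀ z, f (α z) = g z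

/-- The deck transformations of `f` act transitively on each fibre. -/
def FibreTransitive {Y : Subshift B ℤ} {X : Subshift A ℤ} (f : Y.carrier → X.carrier) : Prop :=
  ∀ y y', f y = f y' → ∃ φ ∈ relAut f, φ y = y'

lemma isMapOver_of_mem_relAut {Y : Subshift B ℤ} {X : Subshift A ℤ} {f : Y.carrier → X.carrier}
    {φ : Y.carrier ≃ₜ Y.carrier} (hφ : φ ∈ relAut f) : IsMapOver f f φ :=
  ⟨φ.continuous, hφ.1, hφ.2⟩

lemma IsMapOver.comp {D : Type} [TopologicalSpace D] {W : Subshift D ℤ} {Z : Subshift C ℤ}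
    {Y : Subshift B ℤ} {X : Subshift A ℤ} {f : Y.carrier → X.carrier} {g : Z.carrier → X.carrier}
    {h : W.carrier → X.carrier} {α : Z.carrier → Y.carrier} {β : W.carrier → Z.carrier}
    (hα : IsMapOver f g α) (hβ : IsMapOver g h β) : IsMapOver f h (α ∘ β) :=
  ⟨hα.1.comp hβ.1, hα.2.1.comp hβ.2.1, fun w => (hα.2.2 _).trans (hβ.2.2 w)⟩

/-- Uniqueness of lifts: two maps over `X` which agree at one point are equal, since they agree on
a clopen shift-invariant set. -/
lemma IsMapOver.eq_of_apply_eq [DiscreteTopology B] {Z : Subshift C ℤ} {Y : Subshift B ℤ}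
    {X : Subshift A ℤ} {f : Y.carrier → X.carrier} {g : Z.carrier → X.carrier}
    {α β : Z.carrier → Y.carrier} (hα : IsMapOver f g α) (hβ : IsMapOver f g β)
    (hf : Separated f)
    (hconn : ∀ D : Set Z.carrier, IsClopen D → Invariant Z D → D.Nonempty → D = Set.univ)
    {z : Z.carrier} (hz : α z = β z) : α = β := by
  obtain ⟨k, hk⟩ := hf
  have heq : ∀ z, α z = β z ↔ Agree k (α z).1 (β z).1 :=
    fun z => ⟨fun h => h ▸ fun _ _ _ => rfl, hk _ _ ((hα.2.2 z).trans (hβ.2.2 z).symm)⟩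
  have hset : {z | α z = β z} =
      ⋂ t ∈ Finset.Icc (-(k : ℤ)) k, {z | (α z).1 t = (β z).1 t} := by
    ext z
    have := heq z
    simp only [Agree] at this
    simpa using this
  have hopen : IsOpen {z | α z = β z} := by
    rw [hset]
    refine isOpen_biInter_finset fun t _ => ?_
    have hc : Continuous fun z => ((α z).1 t, (β z).1 t) :=
      ((continuous_apply t).comp (continuous_subtype_val.comp hα.1)).prodMk
        ((continuous_apply t).comp (continuous_subtype_val.comp hβ.1))
    exact (isOpen_discrete {p : B × B | p.1 = p.2}).preimage hc
  have := hconn {z | α z = β z} ⟨isClosed_eq hα.1 hβ.1, hopen⟩ (fun z => ?_) ⟨z, hz⟩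
  · funext z
    exact this.ge (Set.mem_univ z)
  · change α _ = β _ ↔ α z = β z
    rw [hα.2.1, hβ.2.1]
    exact (shiftInt_injective Y 1).eq_iff

lemma IsGalois.isUnramified {Y : Subshift B ℤ} {X : Subshift A ℤ} {f : Y.carrier → X.carrier}
    (hf : IsGalois f) : IsUnramified f := ⟨_, hf.choose_spec.1⟩

lemma IsGalois.isFactorMap {Y : Subshift B ℤ} {X : Subshift A ℤ} {f : Y.carrier → X.carrier}
    (hf : IsGalois f) : IsFactorMap f := hf.choose_spec.1.1

lemma IsGalois.finite_relAut {Y : Subshift B ℤ} {X : Subshift A ℤ} {f : Y.carrier → X.carrier}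
    (hf : IsGalois f) : Finite (relAut f) := by
  obtain ⟨d, hd, hcard⟩ := hf
  have := hd.2.1
  exact Nat.finite_of_card_ne_zero (by omega)

lemma isChoice_rep {X : Subshift A ℤ} {x₀ : X.carrier} :
    IsChoice (rep : ConjClass X x₀ → PointedGaloisFactor X x₀) :=
  Quotient.out_eq

variable [Finite B] [DiscreteTopology B]

/-- A factor map with uniformly separated fibres on which the deck transformations act
transitively is a Galois factor, because the action is free. -/
lemma isGalois_of_fibreTransitive {Y : Subshift B ℤ} {X : Subshift A ℤ}
    {f : Y.carrier → X.carrier} (hY : IsIrreducible Y) [Nonempty Y.carrier] (hf : IsFactorMap f)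
    (hsep : Separated f) (htrans : FibreTransitive f) : IsGalois f := by
  have hcard : ∀ x, (f ⁻¹' {x}).ncard = Nat.card (relAut f) := by
    intro x
    obtain ⟨y, rfl⟩ := hf.2.2 x
    rw [← Nat.card_coe_set_eq]
    refine (Nat.card_congr (Equiv.ofBijective
      (fun φ : relAut f => (⟨φ.1 y, φ.2.2 y⟩ : f ⁻¹' {f y})) ⟨fun φ ψ h => ?_, fun z => ?_⟩)).symm
    · refine Subtype.ext (Homeomorph.ext fun z => ?_)
      exact congrFun ((isMapOver_of_mem_relAut φ.2).eq_of_apply_eq (isMapOver_of_mem_relAut ψ.2)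
        hsep (fun _ => hY.eq_univ_of_isClopen) (congrArg Subtype.val h)) z
    · obtain ⟨φ, hφ, h⟩ := htrans y z.1 z.2.symm
      exact ⟨⟨φ, hφ⟩, Subtype.ext h⟩
  refine ⟨_, ⟨hf, ?_, hcard⟩, rfl⟩
  obtain ⟨y⟩ := ‹Nonempty Y.carrier›
  rw [← hcard (f y)]
  exact (Set.ncard_pos (hsep.finite_fibre _)).2 ⟨y, rfl⟩

lemma IsGalois.fibreTransitive {Y : Subshift B ℤ} {X : Subshift A ℤ} {f : Y.carrier → X.carrier}
    (hf : IsGalois f) (hY : IsIrreducible Y) (hsep : Separated f) : FibreTransitive f := by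
  intro y y' hyy
  have := hf.finite_relAut
  obtain ⟨d, hd, hcard⟩ := hf
  have : Finite (f ⁻¹' {f y}) := hsep.finite_fibre _
  let e : relAut f → f ⁻¹' {f y} := fun φ => ⟨φ.1 y, φ.2.2 y⟩
  have he : Function.Injective e := fun φ ψ h => by
    refine Subtype.ext (Homeomorph.ext fun z => ?_)
    exact congrFun ((isMapOver_of_mem_relAut φ.2).eq_of_apply_eq (isMapOver_of_mem_relAut ψ.2)
      hsep (fun _ => hY.eq_univ_of_isClopen) (congrArg Subtype.val h)) z
  obtain ⟨φ, hφ⟩ := (he.bijective_of_nat_card_le (by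
    rw [hcard, Nat.card_coe_set_eq, hd.2.2])).2 ⟨y', hyy.symm⟩
  exact ⟨φ.1, φ.2, congrArg Subtype.val hφ⟩

end deck

/-! ### Maps between Galois factors -/

section factors

variable {A : Type} [TopologicalSpace A] [Finite A] [DiscreteTopology A]
  {X : Subshift A ℤ} {x₀ : X.carrier}

lemma PointedGaloisFactor.separated (P : PointedGaloisFactor X x₀) : Separated P.ϖ :=
  P.isGalois.isUnramified.separated P.isSFT P.isIrreducible

lemma PointedGaloisFactor.fibreTransitive (P : PointedGaloisFactor X x₀) :
    FibreTransitive P.ϖ :=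
  P.isGalois.fibreTransitive P.isIrreducible P.separated

lemma PointedGaloisFactor.eq_of_apply_eq {P Q : PointedGaloisFactor X x₀}
    {α β : Q.Y.carrier → P.Y.carrier} (hα : IsMapOver P.ϖ Q.ϖ α) (hβ : IsMapOver P.ϖ Q.ϖ β)
    {y : Q.Y.carrier} (hy : α y = β y) : α = β :=
  hα.eq_of_apply_eq hβ P.separated (fun _ => Q.isIrreducible.eq_univ_of_isClopen) hy

lemma gal_ext {P : PointedGaloisFactor X x₀} {φ ψ : Gal P} {y : P.Y.carrier}
    (h : φ.1 y = ψ.1 y) : φ = ψ :=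
  Subtype.ext (Homeomorph.ext fun z => congrFun
    (PointedGaloisFactor.eq_of_apply_eq (isMapOver_of_mem_relAut φ.2)
      (isMapOver_of_mem_relAut ψ.2) h) z)

/-- The translates of the image of a map over `X` by deck transformations are finitely many closed
sets that cover the target and are equal or disjoint, so the image is clopen. -/
lemma IsMapOver.surjective {P Q : PointedGaloisFactor X x₀} {α : Q.Y.carrier → P.Y.carrier}
    (hα : IsMapOver P.ϖ Q.ϖ α) : Function.Surjective α := by
  have := P.isGalois.finite_relAut
  have hclosed : IsClosed (Set.range α) := (isCompact_range hα.1).isClosed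
  have hcompl : (Set.range α)ᶜ =
      ⋃ ψ : {ψ : Gal P // Disjoint (ψ.1 '' Set.range α) (Set.range α)},
        ψ.1.1 '' Set.range α := by
    ext p
    simp only [Set.mem_compl_iff, Set.mem_iUnion]
    constructor
    · intro hp
      obtain ⟨q, hq⟩ := Q.isGalois.isFactorMap.2.2 (P.ϖ p)
      obtain ⟨ψ, hψ, hψp⟩ := P.fibreTransitive (α q) p ((hα.2.2 q).trans hq)
      refine ⟨⟨⟨ψ, hψ⟩, ?_⟩, α q, ⟨q, rfl⟩, hψp⟩
      rw [Set.disjoint_left]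
      rintro _ ⟨_, ⟨q₁, rfl⟩, rfl⟩ ⟨q₂, h12⟩
      apply hp
      obtain ⟨φ, hφ, hφq⟩ := Q.fibreTransitive q₁ q₂ (by
        rw [← hα.2.2 q₁, ← hα.2.2 q₂, h12]
        exact (hψ.2 _).symm)
      have := PointedGaloisFactor.eq_of_apply_eq ((isMapOver_of_mem_relAut hψ).comp hα)
        (hα.comp (isMapOver_of_mem_relAut hφ)) (y := q₁) (by simp [hφq, h12])
      exact ⟨φ q, by rw [← hψp]; exact (congrFun this q).symm⟩
    · rintro ⟨⟨ψ, hψ⟩, h⟩ hp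
      exact Set.disjoint_left.1 hψ h hp
  have hclopen : IsClopen (Set.range α) := by
    refine ⟨hclosed, ?_⟩
    rw [← isClosed_compl_iff, hcompl]
    exact isClosed_iUnion_of_finite fun ψ => (ψ.1.1.isClosed_image).2 hclosed
  rw [← Set.range_eq_univ]
  refine P.isIrreducible.eq_univ_of_isClopen hclopen (fun p => ⟨?_, ?_⟩) ⟨_, Q.y₀, rfl⟩
  · rintro ⟨q, hq⟩
    refine ⟨shiftInt Q.Y (-1) q, shiftInt_injective P.Y 1 ?_⟩
    rw [← hα.2.1.shiftInt, shiftInt_shiftInt, ← shiftMap_eq, ← hq]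
    simp [shiftInt_zero]
  · rintro ⟨q, rfl⟩
    exact ⟨_, hα.2.1 q⟩

/-- Any map over `X` between Galois factors is itself a Galois factor. -/
lemma IsMapOver.isUnramified {P Q : PointedGaloisFactor X x₀} {α : Q.Y.carrier → P.Y.carrier}
    (hα : IsMapOver P.ϖ Q.ϖ α) : IsUnramified α := by
  have : Nonempty Q.Y.carrier := ⟨Q.y₀⟩
  refine (isGalois_of_fibreTransitive Q.isIrreducible ⟨hα.1, hα.2.1, hα.surjective⟩ ?_
    fun q q' h => ?_).isUnramified
  · obtain ⟨k, hk⟩ := Q.separated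
    exact ⟨k, fun q q' h => hk q q' (by rw [← hα.2.2, ← hα.2.2, h])⟩
  · obtain ⟨φ, hφ, hφq⟩ := Q.fibreTransitive q q' (by rw [← hα.2.2, ← hα.2.2, h])
    refine ⟨φ, ⟨hφ.1, fun y => ?_⟩, hφq⟩
    exact congrFun (PointedGaloisFactor.eq_of_apply_eq (hα.comp (isMapOver_of_mem_relAut hφ)) hα
      (y := q) (by simp [hφq, h])) y

lemma isTransition_iff {P Q : PointedGaloisFactor X x₀} {α : Q.Y.carrier → P.Y.carrier} :
    IsTransition P Q α ↔ IsMapOver P.ϖ Q.ϖ α ∧ α Q.y₀ = P.y₀ := by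
  constructor
  · rintro ⟨⟨d, h, -⟩, h2, h3⟩
    exact ⟨⟨h.1, h.2.1, h3⟩, h2⟩
  · rintro ⟨h1, h2⟩
    exact ⟨h1.isUnramified, h2, h1.2.2⟩

lemma IsTransition.isMapOver {P Q : PointedGaloisFactor X x₀} {α : Q.Y.carrier → P.Y.carrier}
    (h : IsTransition P Q α) : IsMapOver P.ϖ Q.ϖ α := (isTransition_iff.1 h).1

lemma IsTransition.unique {P Q : PointedGaloisFactor X x₀} {α β : Q.Y.carrier → P.Y.carrier}
    (hα : IsTransition P Q α) (hβ : IsTransition P Q β) : α = β :=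
  PointedGaloisFactor.eq_of_apply_eq hα.isMapOver hβ.isMapOver (hα.2.1.trans hβ.2.1.symm)

lemma IsTransition.comp {P Q R : PointedGaloisFactor X x₀} {α : Q.Y.carrier → P.Y.carrier}
    {β : R.Y.carrier → Q.Y.carrier} (hα : IsTransition P Q α) (hβ : IsTransition Q R β) :
    IsTransition P R (α ∘ β) :=
  isTransition_iff.2 ⟨hα.isMapOver.comp hβ.isMapOver, by
    rw [Function.comp_apply, hβ.2.1, hα.2.1]⟩

lemma isTransition_id (P : PointedGaloisFactor X x₀) : IsTransition P P id :=
  isTransition_iff.2 ⟨⟨continuous_id, fun _ => rfl, fun _ => rfl⟩, rfl⟩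

/-- A pointed conjugacy over `X` is a transition map. -/
lemma isTransition_of_homeomorph {P Q : PointedGaloisFactor X x₀} {γ : Q.Y.carrier ≃ₜ P.Y.carrier}
    (h1 : ShiftCommuting γ) (h2 : γ Q.y₀ = P.y₀) (h3 : ∀ y, P.ϖ (γ y) = Q.ϖ y) :
    IsTransition P Q γ :=
  isTransition_iff.2 ⟨⟨γ.continuous, h1, h3⟩, h2⟩

lemma exists_isTransition_of_mk_eq {P Q : PointedGaloisFactor X x₀}
    (h : ConjClass.mk P = ConjClass.mk Q) : ∃ α, IsTransition P Q α := by
  obtain ⟨γ, h1, h2, h3⟩ := Quotient.exact h.symm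
  exact ⟨γ, isTransition_of_homeomorph h1 h2 h3⟩

/-! ### The partial order of conjugacy classes -/

lemma mk_le_mk {P Q : PointedGaloisFactor X x₀} :
    ConjClass.mk P ≤ ConjClass.mk Q ↔ ∃ α, IsTransition P Q α := by
  constructor
  · rintro ⟨P', Q', hP, hQ, α, hα⟩
    obtain ⟨β, hβ⟩ := exists_isTransition_of_mk_eq hP.symm
    obtain ⟨γ, hγ⟩ := exists_isTransition_of_mk_eq hQ
    exact ⟨_, hβ.comp (hα.comp hγ)⟩
  · rintro ⟨α, hα⟩
    exact ⟨P, Q, rfl, rfl, α, hα⟩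

lemma IsChoice.le_iff {r : ConjClass X x₀ → PointedGaloisFactor X x₀} (hr : IsChoice r)
    {i j : ConjClass X x₀} : i ≤ j ↔ ∃ α, IsTransition (r i) (r j) α := by
  rw [← mk_le_mk, hr i, hr j]

lemma mk_eq_mk_of_isTransition {P Q : PointedGaloisFactor X x₀} {α : Q.Y.carrier → P.Y.carrier}
    {β : P.Y.carrier → Q.Y.carrier} (hα : IsTransition P Q α) (hβ : IsTransition Q P β) :
    ConjClass.mk P = ConjClass.mk Q := by
  refine Quotient.sound ⟨⟨⟨β, α, congrFun ((hα.comp hβ).unique (isTransition_id P)),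
    congrFun ((hβ.comp hα).unique (isTransition_id Q))⟩, hβ.isMapOver.1, hα.isMapOver.1⟩,
    hβ.isMapOver.2.1, hβ.2.1, hβ.isMapOver.2.2⟩

lemma isPartialOrder_conjClass : IsPartialOrder (ConjClass X x₀) (· ≤ ·) where
  refl i := isChoice_rep.le_iff.2 ⟨_, isTransition_id _⟩
  trans i j k hij hjk := by
    obtain ⟨α, hα⟩ := isChoice_rep.le_iff.1 hij
    obtain ⟨β, hβ⟩ := isChoice_rep.le_iff.1 hjk
    exact isChoice_rep.le_iff.2 ⟨_, hα.comp hβ⟩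
  antisymm i j hij hji := by
    obtain ⟨α, hα⟩ := isChoice_rep.le_iff.1 hij
    obtain ⟨β, hβ⟩ := isChoice_rep.le_iff.1 hji
    rw [← isChoice_rep i, ← isChoice_rep j]
    exact mk_eq_mk_of_isTransition hα hβ

/-! ### The homomorphisms between Galois groups -/

lemma IsMapOver.existsUnique_gal {P Q : PointedGaloisFactor X x₀}
    {α : Q.Y.carrier → P.Y.carrier} (hα : IsMapOver P.ϖ Q.ϖ α) (φ : Gal Q) :
    ∃! ψ : Gal P, ∀ y, ψ.1 (α y) = α (φ.1 y) := by
  obtain ⟨ψ, hψ, h⟩ := P.fibreTransitive (α Q.y₀) (α (φ.1 Q.y₀)) (by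
    rw [hα.2.2, hα.2.2, φ.2.2])
  refine ⟨⟨ψ, hψ⟩, congrFun (PointedGaloisFactor.eq_of_apply_eq
    ((isMapOver_of_mem_relAut hψ).comp hα) (hα.comp (isMapOver_of_mem_relAut φ.2)) h),
    fun ψ' hψ' => gal_ext ((hψ' Q.y₀).trans h.symm)⟩

/-- The homomorphism `Gal(Z/X) → Gal(Y/X)` induced by a map `α : Z → Y` over `X`; it sends `φ` to
the unique `ψ` with `ψ ∘ α = α ∘ φ`. -/
noncomputable def IsMapOver.galHom {P Q : PointedGaloisFactor X x₀}
    {α : Q.Y.carrier → P.Y.carrier} (hα : IsMapOver P.ϖ Q.ϖ α) : Gal Q →* Gal P where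
  toFun φ := (hα.existsUnique_gal φ).choose
  map_one' := ((hα.existsUnique_gal 1).choose_spec.2 1 fun _ => rfl).symm
  map_mul' φ φ' := by
    refine ((hα.existsUnique_gal (φ * φ')).choose_spec.2 _ fun y => ?_).symm
    change (hα.existsUnique_gal φ).choose.1 ((hα.existsUnique_gal φ').choose.1 (α y)) =
      α (φ.1 (φ'.1 y))
    rw [(hα.existsUnique_gal φ').choose_spec.1, (hα.existsUnique_gal φ).choose_spec.1]

lemma IsMapOver.galHom_apply {P Q : PointedGaloisFactor X x₀} {α : Q.Y.carrier → P.Y.carrier}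
    (hα : IsMapOver P.ϖ Q.ϖ α) (φ : Gal Q) (y : Q.Y.carrier) :
    (hα.galHom φ).1 (α y) = α (φ.1 y) :=
  (hα.existsUnique_gal φ).choose_spec.1 y

lemma IsMapOver.galHom_eq_iff {P Q : PointedGaloisFactor X x₀} {α : Q.Y.carrier → P.Y.carrier}
    (hα : IsMapOver P.ϖ Q.ϖ α) (φ : Gal Q) (ψ : Gal P) :
    hα.galHom φ = ψ ↔ ∀ y, ψ.1 (α y) = α (φ.1 y) :=
  ⟨fun h y => h ▸ hα.galHom_apply φ y, fun h => ((hα.existsUnique_gal φ).choose_spec.2 ψ h).symm⟩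

lemma IsMapOver.galHom_surjective {P Q : PointedGaloisFactor X x₀}
    {α : Q.Y.carrier → P.Y.carrier} (hα : IsMapOver P.ϖ Q.ϖ α) :
    Function.Surjective hα.galHom := by
  intro ψ
  obtain ⟨q, hq⟩ := hα.surjective (ψ.1 (α Q.y₀))
  obtain ⟨φ, hφ, h⟩ := Q.fibreTransitive Q.y₀ q (by
    rw [← hα.2.2, ← hα.2.2, hq, ψ.2.2])
  refine ⟨⟨φ, hφ⟩, gal_ext (y := α Q.y₀) ?_⟩
  rw [hα.galHom_apply, ← hq]
  exact congrArg α h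

end factors

/-! ### Transport of Galois factors along conjugacies -/

section transport

variable {A B C D : Type} [TopologicalSpace A] [TopologicalSpace B] [TopologicalSpace C]
  [TopologicalSpace D]

lemma IsGalois.conj {Z : Subshift C ℤ} {Y : Subshift B ℤ} {X : Subshift A ℤ} {X' : Subshift D ℤ}
    {ϖ : Y.carrier → X.carrier} (hϖ : IsGalois ϖ) (f : X.carrier ≃ₜ X'.carrier)
    (hf : ShiftCommuting f) (h : Z.carrier ≃ₜ Y.carrier) (hh : ShiftCommuting h) :
    IsGalois fun z => f (ϖ (h z)) := by
  obtain ⟨d, ⟨⟨hc, hs, hsurj⟩, hd1, hd⟩, hcard⟩ := hϖ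
  refine ⟨d, ⟨⟨f.continuous.comp (hc.comp h.continuous), hf.comp (hs.comp hh),
    f.surjective.comp (hsurj.comp h.surjective)⟩, hd1, fun x => ?_⟩, ?_⟩
  · rw [← hd (f.symm x), ← Nat.card_coe_set_eq, ← Nat.card_coe_set_eq]
    refine Nat.card_congr (h.toEquiv.subtypeEquiv fun z => ?_)
    change f (ϖ (h z)) = x ↔ ϖ (h z) = f.symm x
    rw [Homeomorph.eq_symm_apply]
  · rw [← hcard]
    have key : ∀ φ : Z.carrier ≃ₜ Z.carrier,
        φ ∈ relAut (fun z => f (ϖ (h z))) → (h.symm.trans φ).trans h ∈ relAut ϖ :=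
      fun φ hφ => ⟨hh.comp ((show ShiftCommuting φ from hφ.1).comp hh.homeomorph_symm), fun y => by
        have := f.injective (hφ.2 (h.symm y))
        simpa using this⟩
    refine Nat.card_congr
      { toFun := fun φ => ⟨_, key φ.1 φ.2⟩
        invFun := fun ψ => ⟨(h.trans ψ.1).trans h.symm,
          hh.homeomorph_symm.comp ((show ShiftCommuting ψ.1 from ψ.2.1).comp hh), fun y => by
            simp [ψ.2.2]⟩
        left_inv := fun φ => Subtype.ext (Homeomorph.ext fun y => by simp)
        right_inv := fun ψ => Subtype.ext (Homeomorph.ext fun y => by simp) }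

variable [DiscreteTopology C]

/-- The subshift obtained from `Y` by renaming the letters. -/
def relabel (Y : Subshift B ℤ) (e : B ≃ C) : Subshift C ℤ where
  carrier := {z | e.symm ∘ z ∈ Y.carrier}
  isClosed := Y.isClosed.preimage
    (continuous_pi fun i => continuous_of_discreteTopology.comp (continuous_apply i))
  mapsTo n _ hz := Y.mapsTo n hz

lemma comp_mem_relabel {Y : Subshift B ℤ} (e : B ≃ C) {y : ℤ → B} (hy : y ∈ Y.carrier) :
    e ∘ y ∈ (relabel Y e).carrier := by
  change e.symm ∘ (e ∘ y) ∈ Y.carrier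
  rwa [← Function.comp_assoc, e.symm_comp_self]

/-- Renaming the letters is a conjugacy. -/
def relabelHomeomorph [DiscreteTopology B] (Y : Subshift B ℤ) (e : B ≃ C) :
    (relabel Y e).carrier ≃ₜ Y.carrier where
  toFun z := ⟨e.symm ∘ z.1, z.2⟩
  invFun y := ⟨e ∘ y.1, comp_mem_relabel e y.2⟩
  left_inv _ := Subtype.ext (funext fun _ => e.apply_symm_apply _)
  right_inv _ := Subtype.ext (funext fun _ => e.symm_apply_apply _)
  continuous_toFun := Continuous.subtype_mk (continuous_pi fun i =>
    continuous_of_discreteTopology.comp ((continuous_apply i).comp continuous_subtype_val)) _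
  continuous_invFun := Continuous.subtype_mk (continuous_pi fun i =>
    continuous_of_discreteTopology.comp ((continuous_apply i).comp continuous_subtype_val)) _

lemma shiftCommuting_relabelHomeomorph [DiscreteTopology B] (Y : Subshift B ℤ) (e : B ≃ C) :
    ShiftCommuting (relabelHomeomorph Y e) := fun _ => rfl

lemma IsSFT.relabel [Finite C] {Y : Subshift B ℤ} (hY : IsSFT Y) (e : B ≃ C) :
    IsSFT (relabel Y e) := by
  obtain ⟨m, hm⟩ := hY.exists_hasMemory
  refine HasMemory.isSFT (m := m) fun x hx => hm _ fun i => ?_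
  obtain ⟨y, hy, hxy⟩ := hx i
  exact ⟨_, hy, fun t h1 h2 => congrArg e.symm (hxy t h1 h2)⟩

lemma IsIrreducible.relabel [DiscreteTopology B] {Y : Subshift B ℤ} (hY : IsIrreducible Y)
    (e : B ≃ C) : IsIrreducible (relabel Y e) := by
  refine isIrreducible_of_reach fun k x hx y hy => ?_
  obtain ⟨q, hq, j, hj, h1, h2⟩ := hY.reach k hx hy
  refine ⟨e ∘ q, ((relabelHomeomorph Y e).symm ⟨q, hq⟩).2, j, hj, fun t ht ht' => ?_,
    fun t ht ht' => ?_⟩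
  · have := h1 t ht ht'
    simp [this]
  · have := h2 t ht ht'
    rw [shift_apply] at this
    simp [this]

/-- Every Galois factor over a finite alphabet is conjugate to one over an alphabet `Fin n`. -/
lemma exists_pointedGaloisFactor [Finite B] [DiscreteTopology B] {X : Subshift A ℤ}
    {Y : Subshift B ℤ} (hY : IsSFT Y) (hirr : IsIrreducible Y) {ϖ : Y.carrier → X.carrier}
    (hϖ : IsGalois ϖ) {x₀ : X.carrier} {y₀ : Y.carrier} (hy₀ : ϖ y₀ = x₀) :
    ∃ (P : PointedGaloisFactor X x₀) (h : P.Y.carrier ≃ₜ Y.carrier),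
      ShiftCommuting h ∧ h P.y₀ = y₀ ∧ ∀ y, ϖ (h y) = P.ϖ y := by
  let e := Finite.equivFin B
  refine ⟨⟨_, relabel Y e, hY.relabel e, hirr.relabel e, (relabelHomeomorph Y e).symm y₀,
    fun y => ϖ (relabelHomeomorph Y e y), hϖ.conj (Homeomorph.refl _) (fun _ => rfl) _
      (shiftCommuting_relabelHomeomorph Y e), ?_⟩, relabelHomeomorph Y e,
    shiftCommuting_relabelHomeomorph Y e, ?_, fun _ => rfl⟩
  · simpa using hy₀
  · simp

end transport

/-! ### Irreducible components of Galois coverings -/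

section component

variable {A B : Type} [TopologicalSpace A] [TopologicalSpace B]

/-- A factor map whose deck transformations act transitively on fibres is open, being the quotient
map of a group action. -/
lemma IsFactorMap.isOpenMap [Finite B] [DiscreteTopology A] {F : Subshift B ℤ} {X : Subshift A ℤ}
    {f : F.carrier → X.carrier} (hf : IsFactorMap f) (htrans : FibreTransitive f) :
    IsOpenMap f := by
  intro U hU
  have hq : Topology.IsQuotientMap f := hf.1.isClosedMap.isQuotientMap hf.1 hf.2.2
  rw [← hq.isOpen_preimage]
  have : f ⁻¹' (f '' U) = ⋃ φ ∈ relAut f, φ '' U := by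
    ext z
    simp only [Set.mem_preimage, Set.mem_image, Set.mem_iUnion]
    constructor
    · rintro ⟨y, hy, hyz⟩
      obtain ⟨φ, hφ, h⟩ := htrans y z hyz
      exact ⟨φ, hφ, y, hy, h⟩
    · rintro ⟨φ, hφ, y, hy, rfl⟩
      exact ⟨y, hy, (hφ.2 y).symm⟩
  rw [this]
  exact isOpen_biUnion fun φ _ => φ.isOpenMap U hU

/-- Points over a periodic point are periodic, as the fibres are finite. -/
lemma DensePeriodic.lift [Finite B] [DiscreteTopology A] [DiscreteTopology B] {F : Subshift B ℤ}
    {X : Subshift A ℤ} (hX : DensePeriodic X) {f : F.carrier → X.carrier} (hf : IsFactorMap f)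
    (hopen : IsOpenMap f) (hsep : Separated f) : DensePeriodic F := by
  intro k z hz
  have hU := hopen _ (isOpen_setOf_agree F k z)
  obtain ⟨l, hl⟩ := exists_agree_subset hU (x := f ⟨z, hz⟩) ⟨_, fun _ _ _ => rfl, rfl⟩
  obtain ⟨p, hp, hpz, n, hn, hpn⟩ := hX l _ (f ⟨z, hz⟩).2
  obtain ⟨q, hq, hqp⟩ := hl ⟨p, hp⟩ hpz
  have hmul : ∀ N : ℕ, shiftInt X (N * n) ⟨p, hp⟩ = ⟨p, hp⟩ := by
    intro N
    induction N with
    | zero => simp [shiftInt_zero]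
    | succ N ih =>
      have h1 : shiftInt X n ⟨p, hp⟩ = ⟨p, hp⟩ := Subtype.ext hpn
      rw [Nat.cast_succ, add_mul, one_mul, ← shiftInt_shiftInt, h1, ih]
  have hfin : Finite (f ⁻¹' {(⟨p, hp⟩ : X.carrier)}) := hsep.finite_fibre _
  obtain ⟨a, b, hab, h⟩ := Finite.exists_ne_map_eq_of_infinite fun N : ℕ =>
    (⟨shiftInt F (N * n) q, by
      change f _ = _
      rw [hf.2.1.shiftInt, hqp, hmul]⟩ : f ⁻¹' {(⟨p, hp⟩ : X.carrier)})
  have hper : ∀ a b : ℕ, a < b → shiftInt F (a * n) q = shiftInt F (b * n) q →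
      shift (((b - a) * n : ℕ) : ℤ) q.1 = q.1 := by
    intro a b hab h
    have := congrArg (shiftInt F (-(a * n))) h
    rw [shiftInt_shiftInt, shiftInt_shiftInt, neg_add_cancel, shiftInt_zero] at this
    have h2 := congrArg Subtype.val this
    have h3 : (((b - a) * n : ℕ) : ℤ) = -(a * n) + b * n := by
      push_cast [hab.le]
      ring
    rw [h3]
    exact h2.symm
  have h' := congrArg Subtype.val h
  rcases lt_or_gt_of_ne hab with hlt | hlt
  · exact ⟨q.1, q.2, hq, _, Nat.mul_pos (by omega) hn, hper a b hlt h'⟩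
  · exact ⟨q.1, q.2, hq, _, Nat.mul_pos (by omega) hn, hper b a hlt h'.symm⟩

/-- The subshift of the points of `F` lying in a closed shift-invariant set. -/
def subshiftOf [Finite B] [DiscreteTopology B] (F : Subshift B ℤ) (D : Set F.carrier)
    (hD : IsClosed D) (hinv : Invariant F D) : Subshift B ℤ where
  carrier := Subtype.val '' D
  isClosed := (hD.isCompact.image continuous_subtype_val).isClosed
  mapsTo n := by
    rintro _ ⟨z, hz, rfl⟩
    exact ⟨shiftInt F n z, (hinv.shiftInt n z).2 hz, rfl⟩

lemma Invariant.inter {F : Subshift B ℤ} {D E : Set F.carrier} (hD : Invariant F D)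
    (hE : Invariant F E) : Invariant F (D ∩ E) := fun x => and_congr (hD x) (hE x)

lemma Invariant.compl {F : Subshift B ℤ} {D : Set F.carrier} (hD : Invariant F D) :
    Invariant F Dᶜ := fun x => not_congr (hD x)

variable [Finite A] [DiscreteTopology A] [Finite B]

/-- Among the clopen shift-invariant sets containing `z₀` there is one with the fewest points over
the image of `z₀`. It has no proper nonempty clopen shift-invariant subset, because each such set
meets every fibre. -/
lemma exists_minimal_clopen {F : Subshift B ℤ} {X : Subshift A ℤ} (hX : IsIrreducible X)
    {f : F.carrier → X.carrier} (hf : IsFactorMap f) (hopen : IsOpenMap f) (hsep : Separated f)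
    (z₀ : F.carrier) :
    ∃ D : Set F.carrier, IsClopen D ∧ Invariant F D ∧ z₀ ∈ D ∧
      ∀ E ⊆ D, IsClopen E → Invariant F E → E.Nonempty → E = D := by
  -- a nonempty clopen shift-invariant set has clopen shift-invariant image, which is all of `X`
  have hits : ∀ E : Set F.carrier, IsClopen E → Invariant F E → E.Nonempty →
      ∃ z ∈ E, f z = f z₀ := by
    intro E hE hinv hne
    have := hX.eq_univ_of_isClopen (D := f '' E)
      ⟨(hE.isClosed.isCompact.image hf.1).isClosed, hopen E hE.isOpen⟩ (fun x => ?_)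
      (hne.image f)
    · exact this.ge (Set.mem_univ (f z₀))
    · constructor
      · rintro ⟨z, hz, h⟩
        refine ⟨shiftInt F (-1) z, (hinv.shiftInt _ z).2 hz, shiftInt_injective X 1 ?_⟩
        rw [← hf.2.1.shiftInt, shiftInt_shiftInt, ← shiftMap_eq, ← h]
        simp [shiftInt_zero]
      · rintro ⟨z, hz, rfl⟩
        exact ⟨_, (hinv z).2 hz, hf.2.1 z⟩
  let g : Set F.carrier → ℕ := fun D => (D ∩ f ⁻¹' {f z₀}).ncard
  obtain ⟨D, ⟨hD, hDinv, hzD⟩, hmin⟩ := (measure g).wf.has_min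
    {D | IsClopen D ∧ Invariant F D ∧ z₀ ∈ D}
    ⟨Set.univ, isClopen_univ, fun _ => Iff.rfl, Set.mem_univ _⟩
  have hmem : ∀ E ⊆ D, IsClopen E → Invariant F E → z₀ ∈ E → E = D := by
    intro E hED hE hEinv hzE
    by_contra hne
    obtain ⟨z, hz, hzz⟩ := hits (D ∩ Eᶜ) (hD.inter hE.compl) (hDinv.inter hEinv.compl)
      (Set.sdiff_nonempty.2 fun h => hne (hED.antisymm h))
    refine hmin E ⟨hE, hEinv, hzE⟩ (Set.ncard_lt_ncard ?_
      ((hsep.finite_fibre _).subset Set.inter_subset_right))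
    exact ⟨Set.inter_subset_inter_left _ hED, fun h => hz.2 (h ⟨hz.1, hzz⟩).1⟩
  refine ⟨D, hD, hDinv, hzD, fun E hED hE hEinv hne => ?_⟩
  by_cases hzE : z₀ ∈ E
  · exact hmem E hED hE hEinv hzE
  · have := hmem (D ∩ Eᶜ) Set.inter_subset_left (hD.inter hE.compl) (hDinv.inter hEinv.compl)
      ⟨hzD, hzE⟩
    obtain ⟨z, hz⟩ := hne
    exact absurd hz (this.ge (hED hz)).2

/-- If the deck transformations of `f : F → X` act transitively on the fibres and `F` is a shift
of finite type, then every point of `F` lies in an irreducible component that is a Galois factor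
of `X`. -/
theorem exists_galois_component [DiscreteTopology B] {F : Subshift B ℤ} {X : Subshift A ℤ}
    (hXS : IsSFT X) (hX : IsIrreducible X) {m : ℕ} (hF : HasMemory F m) {f : F.carrier → X.carrier}
    (hf : IsFactorMap f) (hsep : Separated f) (htrans : FibreTransitive f) (z₀ : F.carrier) :
    ∃ (R : Subshift B ℤ) (hR : R.carrier ⊆ F.carrier), z₀.1 ∈ R.carrier ∧ IsSFT R ∧
      IsIrreducible R ∧ IsGalois fun z : R.carrier => f ⟨z.1, hR z.2⟩ := by
  have hopen := hf.isOpenMap htrans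
  obtain ⟨D, hD, hDinv, hzD, hmin⟩ := exists_minimal_clopen hX hf hopen hsep z₀
  let R := subshiftOf F D hD.isClosed hDinv
  have hR : R.carrier ⊆ F.carrier := by
    rintro _ ⟨z, -, rfl⟩
    exact z.2
  let ι : R.carrier → F.carrier := fun z => ⟨z.1, hR z.2⟩
  have hιc : Continuous ι := continuous_subtype_val.subtype_mk _
  have hι : ∀ z, ι z ∈ D := by
    rintro ⟨_, z, hz, rfl⟩
    exact hz
  have hιinj : Function.Injective ι := fun z z' h =>
    Subtype.ext (congrArg (fun w : F.carrier => w.1) h)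
  let κ : ∀ z ∈ D, R.carrier := fun z hz => ⟨z.1, z, hz, rfl⟩
  have hRF : ∀ z (hz : z ∈ D), ι (κ z hz) = z := fun _ _ => rfl
  -- membership in `D` is decided by a window
  obtain ⟨r, hr⟩ := exists_window F ((continuous_boolIndicator_iff_isClopen D).2 hD)
  have hr' : ∀ z z' : F.carrier, Agree r z.1 z'.1 → z' ∈ D → z ∈ D := by
    intro z z' h hz'
    rw [Set.mem_iff_boolIndicator] at hz' ⊢
    rw [hr z z' h, hz']
  have hmem : HasMemory R (m + r) := by
    intro x hx
    have hxF : x ∈ F.carrier := hF x fun i => by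
      obtain ⟨y, hy, h⟩ := hx i
      exact ⟨y, hR hy, h.mono (by omega)⟩
    obtain ⟨y, hy, h⟩ := hx 0
    rw [shift_zero] at h
    exact ⟨⟨x, hxF⟩, hr' _ (ι ⟨y, hy⟩) (h.mono (by omega)) (hι _), rfl⟩
  have hper : DensePeriodic R := by
    intro k x hx
    obtain ⟨p, hp, hpx, hn⟩ := (hX.densePeriodic hXS).lift hf hopen hsep (k + r) x (hR hx)
    exact ⟨p, ⟨⟨p, hp⟩, hr' _ (ι ⟨x, hx⟩) (hpx.mono (by omega)) (hι _), rfl⟩,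
      hpx.mono (by omega), hn⟩
  have hRirr : IsIrreducible R := by
    refine hmem.isIrreducible hper fun E hE hEinv hne => ?_
    have hclosed : ∀ E : Set R.carrier, IsClosed E → IsClosed (ι '' E) := fun E hE =>
      (hE.isCompact.image hιc).isClosed
    have hcompl : (ι '' E)ᶜ = Dᶜ ∪ ι '' Eᶜ := by
      ext z
      constructor
      · intro hz
        by_cases hzD : z ∈ D
        · exact .inr ⟨κ z hzD, fun h => hz ⟨_, h, rfl⟩, rfl⟩
        · exact .inl hzD
      · rintro (hz | ⟨w, hw, rfl⟩) ⟨v, hv, h⟩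
        · exact hz (h ▸ hι v)
        · exact hw (hιinj h ▸ hv)
    have := hmin (ι '' E) ?_ ⟨hclosed E hE.isClosed, ?_⟩ ?_ (hne.image ι)
    · refine Set.eq_univ_of_forall fun z => ?_
      obtain ⟨w, hw, h⟩ := this.ge (hι z)
      exact hιinj h ▸ hw
    · rintro _ ⟨z, -, rfl⟩
      exact hι z
    · rw [← isClosed_compl_iff, hcompl]
      exact hD.compl.isClosed.union (hclosed _ hE.compl.isClosed)
    · intro z
      constructor
      · rintro ⟨w, hw, h⟩
        have hzD : z ∈ D := (hDinv z).1 (h ▸ hι w)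
        have hw' : w = shiftMap R (κ z hzD) := hιinj h
        exact ⟨κ z hzD, (hEinv _).1 (hw' ▸ hw), rfl⟩
      · rintro ⟨w, hw, rfl⟩
        exact ⟨shiftMap R w, (hEinv w).2 hw, rfl⟩
  have : Nonempty R.carrier := ⟨κ z₀ hzD⟩
  refine ⟨R, hR, (κ z₀ hzD).2, hmem.isSFT, hRirr, isGalois_of_fibreTransitive hRirr
    ⟨hf.1.comp hιc, fun z => hf.2.1 (ι z), ?_⟩ ?_ ?_⟩
  · -- the image of `D` is clopen and shift-invariant
    have := hX.eq_univ_of_isClopen (D := f '' D)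
      ⟨(hD.isClosed.isCompact.image hf.1).isClosed, hopen D hD.isOpen⟩ (fun x => ?_)
      ⟨_, z₀, hzD, rfl⟩
    · intro x
      obtain ⟨z, hz, h⟩ := this.ge (Set.mem_univ x)
      exact ⟨κ z hz, h⟩
    · constructor
      · rintro ⟨z, hz, h⟩
        refine ⟨shiftInt F (-1) z, (hDinv.shiftInt _ z).2 hz, shiftInt_injective X 1 ?_⟩
        rw [← hf.2.1.shiftInt, shiftInt_shiftInt, ← shiftMap_eq, ← h]
        simp [shiftInt_zero]
      · rintro ⟨z, hz, rfl⟩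
        exact ⟨_, (hDinv z).2 hz, hf.2.1 z⟩
  · obtain ⟨k, hk⟩ := hsep
    exact ⟨k, fun y y' h h' => hιinj (hk (ι y) (ι y') h h')⟩
  · -- a deck transformation moving a point of `D` to a point of `D` preserves `D`
    have hpres : ∀ φ ∈ relAut f, ∀ z ∈ D, φ z ∈ D → ∀ w ∈ D, φ w ∈ D := by
      intro φ hφ z hz hφz w hw
      have := hmin (D ∩ φ ⁻¹' D) Set.inter_subset_left (hD.inter (hD.preimage φ.continuous))
        (hDinv.inter fun x => by
          change φ (shiftMap F x) ∈ D ↔ φ x ∈ D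
          rw [hφ.1 x, hDinv]) ⟨z, hz, hφz⟩
      exact (this.ge hw).2
    intro y y' h
    obtain ⟨φ, hφ, hφy⟩ := htrans (ι y) (ι y') h
    have h1 := hpres φ hφ (ι y) (hι y) (hφy ▸ hι y')
    have hinv := inv_mem hφ
    have hsymm : φ.symm (ι y') = ι y := by rw [← hφy, Homeomorph.symm_apply_apply]
    have h2 := hpres φ.symm hinv (ι y') (hι y') (hsymm ▸ hι y)
    refine ⟨⟨⟨fun z => κ (φ (ι z)) (h1 _ (hι z)), fun z => κ (φ.symm (ι z)) (h2 _ (hι z)),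
      fun z => hιinj ?_, fun z => hιinj ?_⟩, ?_, ?_⟩, ⟨fun z => hιinj (hφ.1 (ι z)),
        fun z => hφ.2 (ι z)⟩, hιinj hφy⟩
    · simp [hRF]
    · simp [hRF]
    · exact Continuous.subtype_mk (continuous_subtype_val.comp (φ.continuous.comp hιc)) _
    · exact Continuous.subtype_mk (continuous_subtype_val.comp (φ.symm.continuous.comp hιc)) _

end component

/-! ### Fibre products -/

section fibreProduct

variable {A B C : Type} [TopologicalSpace A] [TopologicalSpace B] [TopologicalSpace C]

/-- The points of the fibre product, as sequences of pairs. -/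
def fibreProductSet {X : Subshift A ℤ} {Y : Subshift B ℤ} {Z : Subshift C ℤ}
    (f : Y.carrier → X.carrier) (g : Z.carrier → X.carrier) : Set (ℤ → B × C) :=
  {w | ∃ y z, f y = g z ∧ w = fun i => (y.1 i, z.1 i)}

variable [DiscreteTopology A] [Finite B] [DiscreteTopology B] [Finite C] [DiscreteTopology C]

/-- The fibre product `Y ×_X Z`, a subshift over the product alphabet. -/
def fibreProduct {X : Subshift A ℤ} {Y : Subshift B ℤ} {Z : Subshift C ℤ}
    {f : Y.carrier → X.carrier} {g : Z.carrier → X.carrier} (hf : IsFactorMap f)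
    (hg : IsFactorMap g) : Subshift (B × C) ℤ where
  carrier := fibreProductSet f g
  isClosed := by
    have h1 : IsCompact {p : Y.carrier × Z.carrier | f p.1 = g p.2} :=
      (isClosed_eq (hf.1.comp continuous_fst) (hg.1.comp continuous_snd)).isCompact
    have h2 : Continuous fun p : Y.carrier × Z.carrier => fun i : ℤ => (p.1.1 i, p.2.1 i) :=
      continuous_pi fun i =>
        ((continuous_apply i).comp (continuous_subtype_val.comp continuous_fst)).prodMk
          ((continuous_apply i).comp (continuous_subtype_val.comp continuous_snd))
    have h3 : fibreProductSet f g = (fun p : Y.carrier × Z.carrier =>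
        fun i : ℤ => (p.1.1 i, p.2.1 i)) '' {p | f p.1 = g p.2} := by
      ext w
      constructor
      · rintro ⟨y, z, h, rfl⟩
        exact ⟨(y, z), h, rfl⟩
      · rintro ⟨⟨y, z⟩, h, rfl⟩
        exact ⟨y, z, h, rfl⟩
    rw [h3]
    exact (h1.image h2).isClosed
  mapsTo n := by
    rintro _ ⟨y, z, h, rfl⟩
    exact ⟨shiftInt Y n y, shiftInt Z n z, by rw [hf.2.1.shiftInt, hg.2.1.shiftInt, h], rfl⟩

variable {X : Subshift A ℤ} {Y : Subshift B ℤ} {Z : Subshift C ℤ} {f : Y.carrier → X.carrier}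
  {g : Z.carrier → X.carrier} (hf : IsFactorMap f) (hg : IsFactorMap g)

namespace fibreProduct

/-- The first projection of the fibre product. -/
def fst (w : (fibreProduct hf hg).carrier) : Y.carrier :=
  ⟨fun i => (w.1 i).1, by
    obtain ⟨y, z, -, h⟩ := w.2
    rw [h]
    exact y.2⟩

/-- The second projection of the fibre product. -/
def snd (w : (fibreProduct hf hg).carrier) : Z.carrier :=
  ⟨fun i => (w.1 i).2, by
    obtain ⟨y, z, -, h⟩ := w.2
    rw [h]
    exact z.2⟩

/-- The point of the fibre product with given components. -/
def mk (y : Y.carrier) (z : Z.carrier) (h : f y = g z) : (fibreProduct hf hg).carrier :=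
  ⟨fun i => (y.1 i, z.1 i), y, z, h, rfl⟩

lemma condition (w : (fibreProduct hf hg).carrier) : f (fst hf hg w) = g (snd hf hg w) := by
  obtain ⟨_, y, z, h, rfl⟩ := w
  exact h

lemma ext {w w' : (fibreProduct hf hg).carrier} (h1 : fst hf hg w = fst hf hg w')
    (h2 : snd hf hg w = snd hf hg w') : w = w' :=
  Subtype.ext (funext fun i => Prod.ext (congrFun (congrArg Subtype.val h1) i)
    (congrFun (congrArg Subtype.val h2) i))

lemma continuous_fst : Continuous (fst hf hg) :=
  Continuous.subtype_mk (continuous_pi fun i =>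
    _root_.continuous_fst.comp ((continuous_apply i).comp continuous_subtype_val)) _

lemma continuous_snd : Continuous (snd hf hg) :=
  Continuous.subtype_mk (continuous_pi fun i =>
    _root_.continuous_snd.comp ((continuous_apply i).comp continuous_subtype_val)) _

lemma isFactorMap : IsFactorMap fun w => f (fst hf hg w) := by
  refine ⟨hf.1.comp (continuous_fst hf hg), fun w => hf.2.1 (fst hf hg w), fun x => ?_⟩
  obtain ⟨y, rfl⟩ := hf.2.2 x
  obtain ⟨z, hz⟩ := hg.2.2 (f y)
  exact ⟨mk hf hg y z hz.symm, rfl⟩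

lemma separated (hfs : Separated f) (hgs : Separated g) :
    Separated fun w => f (fst hf hg w) := by
  obtain ⟨k, hk⟩ := hfs
  obtain ⟨l, hl⟩ := hgs
  refine ⟨max k l, fun w w' h hag => ext hf hg (hk _ _ h fun t h1 h2 => ?_)
    (hl _ _ (by rw [← condition hf hg, ← condition hf hg]; exact h) fun t h1 h2 => ?_)⟩
  · exact congrArg Prod.fst (hag t (by omega) (by omega))
  · exact congrArg Prod.snd (hag t (by omega) (by omega))

/-- Deck transformations of both factors act jointly on the fibre product. -/
def mapHomeomorph {φ : Y.carrier ≃ₜ Y.carrier} {ψ : Z.carrier ≃ₜ Z.carrier} (hφ : φ ∈ relAut f)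
    (hψ : ψ ∈ relAut g) :
    (fibreProduct hf hg).carrier ≃ₜ (fibreProduct hf hg).carrier where
  toFun w := mk hf hg (φ (fst hf hg w)) (ψ (snd hf hg w)) (by
    rw [hφ.2, hψ.2, condition hf hg])
  invFun w := mk hf hg (φ.symm (fst hf hg w)) (ψ.symm (snd hf hg w)) (by
    rw [show f (φ.symm _) = f _ from (inv_mem hφ).2 _,
      show g (ψ.symm _) = g _ from (inv_mem hψ).2 _, condition hf hg])
  left_inv w := ext hf hg (φ.symm_apply_apply _) (ψ.symm_apply_apply _)
  right_inv w := ext hf hg (φ.apply_symm_apply _) (ψ.apply_symm_apply _)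
  continuous_toFun := Continuous.subtype_mk (continuous_pi fun i =>
    ((continuous_apply i).comp (continuous_subtype_val.comp
      (φ.continuous.comp (continuous_fst hf hg)))).prodMk
    ((continuous_apply i).comp (continuous_subtype_val.comp
      (ψ.continuous.comp (continuous_snd hf hg))))) _
  continuous_invFun := Continuous.subtype_mk (continuous_pi fun i =>
    ((continuous_apply i).comp (continuous_subtype_val.comp
      (φ.symm.continuous.comp (continuous_fst hf hg)))).prodMk
    ((continuous_apply i).comp (continuous_subtype_val.comp
      (ψ.symm.continuous.comp (continuous_snd hf hg))))) _

lemma fibreTransitive (hft : FibreTransitive f) (hgt : FibreTransitive g) :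
    FibreTransitive fun w => f (fst hf hg w) := by
  intro w w' h
  obtain ⟨φ, hφ, h1⟩ := hft _ _ h
  obtain ⟨ψ, hψ, h2⟩ := hgt (snd hf hg w) (snd hf hg w') (by
    rw [← condition hf hg, ← condition hf hg]; exact h)
  refine ⟨mapHomeomorph hf hg hφ hψ, ⟨fun v => ?_, fun v => hφ.2 _⟩, ext hf hg h1 h2⟩
  exact ext hf hg (hφ.1 (fst hf hg v)) (hψ.1 (snd hf hg v))

lemma exists_hasMemory (hY : IsSFT Y) (hZ : IsSFT Z) : ∃ m, HasMemory (fibreProduct hf hg) m := by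
  obtain ⟨m, hm⟩ := hY.exists_hasMemory
  obtain ⟨n, hn⟩ := hZ.exists_hasMemory
  obtain ⟨r, hr⟩ := hf.2.1.exists_block hf.1
  obtain ⟨s, hs⟩ := hg.2.1.exists_block hg.1
  refine ⟨m + n + r + s, fun x hx => ?_⟩
  choose v hv hxv using hx
  have hy : (fun i => (x i).1) ∈ Y.carrier := hm _ fun i =>
    ⟨_, (fst hf hg ⟨v i, hv i⟩).2, fun t h1 h2 =>
      congrArg Prod.fst (hxv i t (by omega) (by omega))⟩
  have hz : (fun i => (x i).2) ∈ Z.carrier := hn _ fun i =>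
    ⟨_, (snd hf hg ⟨v i, hv i⟩).2, fun t h1 h2 =>
      congrArg Prod.snd (hxv i t (by omega) (by omega))⟩
  refine ⟨⟨_, hy⟩, ⟨_, hz⟩, Subtype.ext (funext fun i => ?_), rfl⟩
  -- around `i` both components follow the point `v i` of the fibre product, shifted by `-i`
  have key := congrArg (fun p => (shiftInt X (-i) p).1 i) (condition hf hg ⟨v i, hv i⟩)
  simp only [← hf.2.1.shiftInt, ← hg.2.1.shiftInt] at key
  rw [hr ⟨_, hy⟩ (shiftInt Y (-i) (fst hf hg ⟨v i, hv i⟩)) i fun t h1 h2 => ?_, key,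
    hs ⟨_, hz⟩ (shiftInt Z (-i) (snd hf hg ⟨v i, hv i⟩)) i fun t h1 h2 => ?_]
  · have := hxv i (-i + t) (by omega) (by omega)
    rw [shift_apply, add_neg_cancel_left] at this
    exact congrArg Prod.snd this
  · have := hxv i (-i + t) (by omega) (by omega)
    rw [shift_apply, add_neg_cancel_left] at this
    exact congrArg Prod.fst this

end fibreProduct

end fibreProduct

/-! ### The Galois factors form a nonempty directed system -/

section directed

variable {A : Type} [TopologicalSpace A] [Finite A] [DiscreteTopology A] {X : Subshift A ℤ}
  {x₀ : X.carrier}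

lemma PointedGaloisFactor.exists_common (hXS : IsSFT X) (hX : IsIrreducible X)
    (P Q : PointedGaloisFactor X x₀) :
    ∃ (R : PointedGaloisFactor X x₀) (α : R.Y.carrier → P.Y.carrier)
      (β : R.Y.carrier → Q.Y.carrier), IsTransition P R α ∧ IsTransition Q R β := by
  have hP := P.isGalois.isFactorMap
  have hQ := Q.isGalois.isFactorMap
  obtain ⟨m, hm⟩ := fibreProduct.exists_hasMemory hP hQ P.isSFT Q.isSFT
  let w₀ := fibreProduct.mk hP hQ P.y₀ Q.y₀ (P.map_base.trans Q.map_base.symm)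
  obtain ⟨S, hS, hwS, hSsft, hSirr, hSgal⟩ := exists_galois_component hXS hX hm
    (fibreProduct.isFactorMap hP hQ) (fibreProduct.separated hP hQ P.separated Q.separated)
    (fibreProduct.fibreTransitive hP hQ P.fibreTransitive Q.fibreTransitive) w₀
  obtain ⟨R, h, h1, h2, h3⟩ := exists_pointedGaloisFactor hSsft hSirr hSgal
    (y₀ := ⟨w₀.1, hwS⟩) P.map_base
  let ι : S.carrier → (fibreProduct hP hQ).carrier := fun z => ⟨z.1, hS z.2⟩
  have hι : Continuous ι := continuous_subtype_val.subtype_mk _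
  refine ⟨R, fun y => fibreProduct.fst hP hQ (ι (h y)),
    fun y => fibreProduct.snd hP hQ (ι (h y)), isTransition_iff.2 ⟨⟨?_, ?_, ?_⟩, ?_⟩,
    isTransition_iff.2 ⟨⟨?_, ?_, ?_⟩, ?_⟩⟩
  · exact (fibreProduct.continuous_fst hP hQ).comp (hι.comp h.continuous)
  · exact fun y => congrArg (fun z => fibreProduct.fst hP hQ (ι z)) (h1 y)
  · exact h3
  · rw [h2]
    rfl
  · exact (fibreProduct.continuous_snd hP hQ).comp (hι.comp h.continuous)
  · exact fun y => congrArg (fun z => fibreProduct.snd hP hQ (ι z)) (h1 y)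
  · exact fun y => (fibreProduct.condition hP hQ (ι (h y))).symm.trans (h3 y)
  · rw [h2]
    rfl

lemma isDirectedOrder_conjClass (hXS : IsSFT X) (hX : IsIrreducible X) :
    IsDirectedOrder (ConjClass X x₀) where
  directed i j := by
    obtain ⟨R, α, β, hα, hβ⟩ := PointedGaloisFactor.exists_common hXS hX (rep i) (rep j)
    exact ⟨ConjClass.mk R, by rw [← isChoice_rep i]; exact mk_le_mk.2 ⟨α, hα⟩,
      by rw [← isChoice_rep j]; exact mk_le_mk.2 ⟨β, hβ⟩⟩

lemma isGalois_id (hX : IsIrreducible X) [Nonempty X.carrier] :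
    IsGalois (id : X.carrier → X.carrier) :=
  isGalois_of_fibreTransitive hX ⟨continuous_id, fun _ => rfl, Function.surjective_id⟩
    ⟨0, fun _ _ h _ => h⟩ fun _ _ h => ⟨1, one_mem _, h⟩

lemma nonempty_conjClass (hXS : IsSFT X) (hX : IsIrreducible X) : Nonempty (ConjClass X x₀) := by
  have : Nonempty X.carrier := ⟨x₀⟩
  obtain ⟨P, -⟩ := exists_pointedGaloisFactor hXS hX (isGalois_id hX)
    (x₀ := x₀) rfl
  exact ⟨ConjClass.mk P⟩

end directed

/-! ### First cohomology with trivial coefficients -/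

section cohomology

open CategoryTheory TopRep ContinuousCohomology

variable {p : ℕ} {G : Type} [Group G] [TopologicalSpace G] [IsTopologicalGroup G]

/-- A homogeneous 1-cochain with values in `𝔽_p`, as a function of two variables. -/
def cochainFun (v : (homogeneousCochains (trivialModule p G)).X 1) : C(G, C(G, ZMod p)) := v.1

lemma cochainFun_eq (v : (homogeneousCochains (trivialModule p G)).X 1) (x y : G) :
    cochainFun v x y = cochainFun v 1 (x⁻¹ * y) := by
  have h := (ContRepresentation.mem_invariants _).1 v.2 x
  have h1 : cochainFun v (x⁻¹ * x) (x⁻¹ * y) = cochainFun v x y :=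
    DFunLike.congr_fun (DFunLike.congr_fun h x) y
  rw [← h1, inv_mul_cancel]

lemma resolution_d_one_apply (v : C(G, ZMod p)) (x y : G) :
    ((d (trivialModule p G) 1).hom v : C(G, C(G, ZMod p))) x y = v y - v x := rfl

/-- Invariant 0-cochains with trivial coefficients are constant, so their differential vanishes. -/
lemma homogeneousCochains_d_zero_one :
    (homogeneousCochains (trivialModule p G)).d 0 1 = 0 := by
  ext v : 2
  refine Subtype.ext ((homogeneousCochains.d_apply _ 0 v).trans ?_)
  let w : C(G, ZMod p) := v.1
  have hw : ∀ x, w x = w 1 := fun x => by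
    have h := (ContRepresentation.mem_invariants _).1 v.2 x
    have h1 : w (x⁻¹ * x) = w x := DFunLike.congr_fun h x
    rw [← h1, inv_mul_cancel]
  refine ContinuousMap.ext fun x => ContinuousMap.ext fun y => ?_
  refine (resolution_d_one_apply w x y).trans ?_
  rw [hw x, hw y, sub_self]
  rfl

/-- By definition, the differential of a 1-cochain `v` is
`(x, y, z) ↦ v(y, z) - (v(x, z) - v(x, y))`. -/
lemma homogeneousCochains_d_one_two_eq_zero_iff
    (v : (homogeneousCochains (trivialModule p G)).X 1) :
    ((homogeneousCochains (trivialModule p G)).d 1 2).hom v = 0 ↔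
      ∀ x y z, cochainFun v y z - (cochainFun v x z - cochainFun v x y) = 0 := by
  constructor
  · intro h x y z
    have h1 := (homogeneousCochains.d_apply (trivialModule p G) 1 v).symm.trans
      (congrArg Subtype.val h)
    exact DFunLike.congr_fun (DFunLike.congr_fun (DFunLike.congr_fun h1 x) y) z
  · intro h
    refine Subtype.ext ((homogeneousCochains.d_apply _ 1 v).trans ?_)
    exact ContinuousMap.ext fun x => ContinuousMap.ext fun y => ContinuousMap.ext fun z => h x y z

lemma hom_hom_apply_eq_zero {R : Type*} [Ring R] [TopologicalSpace R] {L M N : TopModuleCat R}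
    {a : L ⟶ M} {b : M ⟶ N} (h : a ≫ b = 0) (x : L) : b.hom (a.hom x) = 0 := by
  change (a ≫ b).hom x = 0
  rw [h]
  rfl

lemma cocycleValue_mul (σ : cocycles (trivialModule p G) 1) (g h : G) :
    cocycleValue σ (g * h) = cocycleValue σ g + cocycleValue σ h := by
  have h0 : ((homogeneousCochains (trivialModule p G)).d 1 2).hom
      (((homogeneousCochains (trivialModule p G)).iCycles 1).hom σ) = 0 :=
    hom_hom_apply_eq_zero (HomologicalComplex.iCycles_d _ 1 2) σ
  have h1 := (homogeneousCochains_d_one_two_eq_zero_iff _).1 h0 1 g (g * h)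
  rw [cochainFun_eq _ g, inv_mul_cancel_left, sub_eq_zero, eq_sub_iff_add_eq'] at h1
  exact h1.symm

variable (p G) in
/-- The map `σ ↦ σ(1, ·)` from 1-cocycles to homomorphisms. -/
noncomputable def cocyclesToHomCont : cocycles (trivialModule p G) 1 →ₗ[ZMod p] HomCont p G where
  toFun σ := ⟨cochainFun (((homogeneousCochains (trivialModule p G)).iCycles 1).hom σ) 1,
    cocycleValue_mul σ⟩
  map_add' σ τ := Subtype.ext (congrArg (fun v => cochainFun v 1) (map_add
    ((homogeneousCochains (trivialModule p G)).iCycles 1).hom σ τ))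
  map_smul' c σ := Subtype.ext (congrArg (fun v => cochainFun v 1) (map_smul
    ((homogeneousCochains (trivialModule p G)).iCycles 1).hom c σ))

lemma iCycles_injective : Function.Injective
    ((homogeneousCochains (trivialModule p G)).iCycles 1).hom := by
  set K := homogeneousCochains (trivialModule p G) with hK
  let k : K.cycles 1 ⟶ TopModuleCat.ker (K.d 1 2) :=
    (TopModuleCat.isLimitKer (K.d 1 2)).lift (Limits.KernelFork.ofι (K.iCycles 1) (K.iCycles_d 1 2))
  have hk : k ≫ TopModuleCat.kerι (K.d 1 2) = K.iCycles 1 :=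
    Limits.Fork.IsLimit.lift_ι (TopModuleCat.isLimitKer (K.d 1 2))
  let l : TopModuleCat.ker (K.d 1 2) ⟶ K.cycles 1 :=
    K.liftCycles (TopModuleCat.kerι (K.d 1 2)) 2 (by simp) (TopModuleCat.kerι_comp _)
  have hl : l ≫ K.iCycles 1 = TopModuleCat.kerι (K.d 1 2) := K.liftCycles_i _ _ _ _
  have hkl : k ≫ l = 𝟙 _ := by
    rw [← cancel_mono (K.iCycles 1), Category.assoc, hl, hk, Category.id_comp]
  have hleft : Function.LeftInverse l.hom k.hom := fun σ => ConcreteCategory.congr_hom hkl σ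
  intro σ τ h
  apply hleft.injective
  refine Subtype.ext ?_
  have h1 := ConcreteCategory.congr_hom hk σ
  have h2 := ConcreteCategory.congr_hom hk τ
  exact h1.trans (h.trans h2.symm)

/-- The invariant cochain `(x, y) ↦ χ(x⁻¹ y)` attached to a homomorphism `χ`. -/
def homContCochain (χ : HomCont p G) : (homogeneousCochains (trivialModule p G)).X 1 :=
  ⟨(ContinuousMap.curry ⟨fun q : G × G => χ.1 (q.1⁻¹ * q.2), by fun_prop⟩ : C(G, C(G, ZMod p))),
    (ContRepresentation.mem_invariants _).2 fun g => ContinuousMap.ext fun x =>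
      ContinuousMap.ext fun y => by
        change χ.1 ((g⁻¹ * x)⁻¹ * (g⁻¹ * y)) = χ.1 (x⁻¹ * y)
        congr 1
        group⟩

lemma homCont_inv {G : Type} [Group G] [TopologicalSpace G] (χ : HomCont p G) (g : G) :
    χ.1 g⁻¹ = -χ.1 g := by
  have h1 := χ.2 1 1
  have h2 := χ.2 g⁻¹ g
  rw [mul_one, left_eq_add] at h1
  rw [inv_mul_cancel, h1] at h2
  exact eq_neg_of_add_eq_zero_left h2.symm

lemma cocyclesToHomCont_bijective : Function.Bijective (cocyclesToHomCont p G) := by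
  constructor
  · intro σ τ h
    apply iCycles_injective
    refine Subtype.ext (ContinuousMap.ext fun x => ContinuousMap.ext fun y => ?_)
    refine (cochainFun_eq _ x y).trans (Eq.trans ?_ (cochainFun_eq _ x y).symm)
    exact DFunLike.congr_fun (congrArg Subtype.val h) (x⁻¹ * y)
  · intro χ
    set K := homogeneousCochains (trivialModule p G) with hK
    let l : TopModuleCat.ker (K.d 1 2) ⟶ K.cycles 1 :=
      K.liftCycles (TopModuleCat.kerι (K.d 1 2)) 2 (by simp) (TopModuleCat.kerι_comp _)
    have hl : l ≫ K.iCycles 1 = TopModuleCat.kerι (K.d 1 2) := K.liftCycles_i _ _ _ _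
    have hχ : (K.d 1 2).hom (homContCochain χ) = 0 := by
      refine (homogeneousCochains_d_one_two_eq_zero_iff _).2 fun x y z => ?_
      change χ.1 (y⁻¹ * z) - (χ.1 (x⁻¹ * z) - χ.1 (x⁻¹ * y)) = 0
      rw [χ.2, χ.2, χ.2, homCont_inv χ, homCont_inv χ]
      ring
    refine ⟨l.hom ⟨homContCochain χ, hχ⟩, Subtype.ext (ContinuousMap.ext fun g => ?_)⟩
    have h1 : (K.iCycles 1).hom (l.hom ⟨homContCochain χ, hχ⟩) = homContCochain χ :=
      ConcreteCategory.congr_hom hl _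
    change cochainFun ((K.iCycles 1).hom (l.hom ⟨homContCochain χ, hχ⟩)) 1 g = χ.1 g
    rw [h1]
    change χ.1 (1⁻¹ * g) = χ.1 g
    rw [inv_one, one_mul]

/-- With trivial coefficients there are no nonzero 1-coboundaries, so the first cohomology is the
space of 1-cocycles, which are the homomorphisms. -/
theorem exists_h1_equiv_homCont : ∃ e : H1 p G ≃ₗ[ZMod p] HomCont p G,
    ∀ σ g, (e ((ContinuousCohomology.π (trivialModule p G) 1).hom σ)).1 g = cocycleValue σ g := by
  have : IsIso ((homogeneousCochains (trivialModule p G)).homologyπ 1) :=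
    HomologicalComplex.isIso_homologyπ _ 0 1 (by simp) homogeneousCochains_d_zero_one
  let a := (asIso ((homogeneousCochains (trivialModule p G)).homologyπ 1)).toContinuousLinearEquiv
  refine ⟨a.symm.toLinearEquiv.trans
    (LinearEquiv.ofBijective (cocyclesToHomCont p G) cocyclesToHomCont_bijective), fun σ g => ?_⟩
  have h : a.symm (a σ) = σ := a.symm_apply_apply σ
  exact congrArg (fun τ => ((cocyclesToHomCont p G) τ).1 g) h

/-- Continuous homomorphisms to `𝔽_p` depend only on the topological group. -/
def homContCongr {H : Type} [Group H] [TopologicalSpace H] (e : G ≃ₜ* H) :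
    HomCont p G ≃ₗ[ZMod p] HomCont p H where
  toFun χ := ⟨χ.1.comp ⟨e.symm, e.symm.continuous⟩, fun g h => by
    simp only [ContinuousMap.comp_apply, ContinuousMap.coe_mk, map_mul]
    exact χ.2 _ _⟩
  invFun χ := ⟨χ.1.comp ⟨e, e.continuous⟩, fun g h => by
    simp only [ContinuousMap.comp_apply, ContinuousMap.coe_mk, map_mul]
    exact χ.2 _ _⟩
  map_add' _ _ := rfl
  map_smul' _ _ := rfl
  left_inv χ := by
    ext g
    simp
  right_inv χ := by
    ext g
    simp

end cohomology

/-! ### The limit group and its independence of all choices -/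

section limit

variable {A A' : Type} [TopologicalSpace A] [TopologicalSpace A']
  {X : Subshift A ℤ} {X' : Subshift A' ℤ} {x₀ : X.carrier} {x₀' : X'.carrier}

lemma compactSpace_limitGroup (r : ConjClass X x₀ → PointedGaloisFactor X x₀) :
    CompactSpace (limitGroup r) := by
  have hfin : ∀ i, Finite (Gal (r i)) := fun i => (r i).isGalois.finite_relAut
  suffices h : IsCompact (limitGroup r : Set (∀ i, Gal (r i))) from
    isCompact_iff_compactSpace.1 h
  have heq : (limitGroup r : Set (∀ i, Gal (r i))) = ⋂ (i) (j) (α)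
      (_ : IsTransition (r i) (r j) α) (y), {g | (g i).1 (α y) = α ((g j).1 y)} := by
    ext g
    simp [limitGroup]
  rw [heq]
  refine IsClosed.isCompact (isClosed_iInter fun i => isClosed_iInter fun j =>
    isClosed_iInter fun α => isClosed_iInter fun _ => isClosed_iInter fun y => ?_)
  exact (isClosed_discrete {q : Gal (r i) × Gal (r j) | q.1.1 (α y) = α (q.2.1 y)}).preimage
    (f := fun g : ∀ i, Gal (r i) => (g i, g j)) ((continuous_apply i).prodMk (continuous_apply j))

/-- Conjugation by a homeomorphism `γ` lying over a homeomorphism `f` of the bases. -/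
def galCongr {P : PointedGaloisFactor X x₀} {P' : PointedGaloisFactor X' x₀'}
    {f : X.carrier ≃ₜ X'.carrier} {γ : P.Y.carrier ≃ₜ P'.Y.carrier} (hγ : ShiftCommuting γ)
    (hf : ∀ y, P'.ϖ (γ y) = f (P.ϖ y)) : Gal P ≃* Gal P' where
  toFun φ := ⟨(γ.symm.trans φ.1).trans γ,
    hγ.comp ((show ShiftCommuting φ.1 from φ.2.1).comp hγ.homeomorph_symm), fun y => by
      change P'.ϖ (γ (φ.1 (γ.symm y))) = P'.ϖ y
      rw [hf, φ.2.2, ← hf, γ.apply_symm_apply]⟩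
  invFun ψ := ⟨(γ.trans ψ.1).trans γ.symm,
    hγ.homeomorph_symm.comp ((show ShiftCommuting ψ.1 from ψ.2.1).comp hγ), fun y => by
      apply f.injective
      rw [← hf, ← hf]
      change P'.ϖ (γ (γ.symm (ψ.1 (γ y)))) = _
      rw [γ.apply_symm_apply, ψ.2.2]⟩
  left_inv φ := Subtype.ext (Homeomorph.ext fun y => by simp)
  right_inv φ := Subtype.ext (Homeomorph.ext fun y => by simp)
  map_mul' φ φ' := Subtype.ext (Homeomorph.ext fun y => by simp)

lemma galCongr_symm_apply {P : PointedGaloisFactor X x₀} {P' : PointedGaloisFactor X' x₀'}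
    {f : X.carrier ≃ₜ X'.carrier} {γ : P.Y.carrier ≃ₜ P'.Y.carrier} (hγ : ShiftCommuting γ)
    (hf : ∀ y, P'.ϖ (γ y) = f (P.ϖ y)) (ψ : Gal P') (y : P.Y.carrier) :
    ((galCongr hγ hf).symm ψ).1 y = γ.symm (ψ.1 (γ y)) := rfl

lemma galCongr_apply {P : PointedGaloisFactor X x₀} {P' : PointedGaloisFactor X' x₀'}
    {f : X.carrier ≃ₜ X'.carrier} {γ : P.Y.carrier ≃ₜ P'.Y.carrier} (hγ : ShiftCommuting γ)
    (hf : ∀ y, P'.ϖ (γ y) = f (P.ϖ y)) (φ : Gal P) (y : P.Y.carrier) :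
    (galCongr hγ hf φ).1 (γ y) = γ (φ.1 y) :=
  congrArg (fun z => γ (φ.1 z)) (γ.symm_apply_apply y)

/-- Limit groups are isomorphic if their index sets are in bijection and the corresponding factors
are related by homeomorphisms over the bases that match up the transition maps. -/
lemma nonempty_limitGroup_equiv {r : ConjClass X x₀ → PointedGaloisFactor X x₀}
    {r' : ConjClass X' x₀' → PointedGaloisFactor X' x₀'} {f : X.carrier ≃ₜ X'.carrier}
    {e : ConjClass X x₀ → ConjClass X' x₀'} (he : Function.Bijective e)
    (γ : ∀ i, (r i).Y.carrier ≃ₜ (r' (e i)).Y.carrier) (hγ : ∀ i, ShiftCommuting (γ i))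
    (hγf : ∀ i y, (r' (e i)).ϖ (γ i y) = f ((r i).ϖ y))
    (hα : ∀ i j (α : (r j).Y.carrier → (r i).Y.carrier), IsTransition (r i) (r j) α →
      IsTransition (r' (e i)) (r' (e j)) (γ i ∘ α ∘ (γ j).symm))
    (hα' : ∀ i j (α : (r' (e j)).Y.carrier → (r' (e i)).Y.carrier),
      IsTransition (r' (e i)) (r' (e j)) α → IsTransition (r i) (r j) ((γ i).symm ∘ α ∘ γ j)) :
    Nonempty (limitGroup r ≃ₜ* limitGroup r') := by
  let θ : ∀ i, Gal (r i) ≃* Gal (r' (e i)) := fun i => galCongr (hγ i) (hγf i)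
  let Φ : limitGroup r' →* limitGroup r :=
    { toFun := fun g => ⟨fun i => (θ i).symm (g.1 (e i)), fun i j α h y => by
        have := g.2 _ _ _ (hα i j α h) (γ j y)
        simp only [Function.comp_apply, Homeomorph.symm_apply_apply] at this
        simp only [θ, galCongr_symm_apply]
        rw [this, Homeomorph.symm_apply_apply]⟩
      map_one' := Subtype.ext (funext fun i => map_one (θ i).symm)
      map_mul' := fun g h => Subtype.ext (funext fun i => map_mul (θ i).symm _ _) }
  have hΦc : Continuous Φ := Continuous.subtype_mk (continuous_pi fun i =>
    continuous_of_discreteTopology.comp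
      ((continuous_apply (e i)).comp continuous_subtype_val)) _
  have hΦ : Function.Bijective Φ := by
    constructor
    · intro g h hgh
      refine Subtype.ext (funext fun i' => ?_)
      obtain ⟨i, rfl⟩ := he.2 i'
      exact (θ i).symm.injective (congrFun (congrArg Subtype.val hgh) i)
    · intro g
      let g' : ∀ i', Gal (r' i') :=
        Equiv.piCongrLeft (fun i' => Gal (r' i')) (Equiv.ofBijective e he) fun i => θ i (g.1 i)
      have hg' : ∀ i, g' (e i) = θ i (g.1 i) := fun i =>
        Equiv.piCongrLeft_apply_apply (fun i' => Gal (r' i')) (Equiv.ofBijective e he) _ i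
      refine ⟨⟨g', fun i' j' α h y => ?_⟩, Subtype.ext (funext fun i => ?_)⟩
      · obtain ⟨i, rfl⟩ := he.2 i'
        obtain ⟨j, rfl⟩ := he.2 j'
        obtain ⟨z, rfl⟩ := (γ j).surjective y
        have := g.2 _ _ _ (hα' i j α h) z
        rw [hg', hg', galCongr_apply]
        rw [← (γ i).apply_symm_apply (α (γ j z)), galCongr_apply]
        exact (congrArg (γ i) this).trans ((γ i).apply_symm_apply _)
      · change (θ i).symm (g' (e i)) = g.1 i
        rw [hg', MulEquiv.symm_apply_apply]
  have := compactSpace_limitGroup r'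
  let h := Continuous.homeoOfEquivCompactToT2 (f := Equiv.ofBijective Φ hΦ) hΦc
  exact ⟨ContinuousMulEquiv.symm
    { MulEquiv.ofBijective Φ hΦ with
      continuous_toFun := hΦc
      continuous_invFun := h.symm.continuous }⟩

end limit

section invariance

variable {A A' : Type} [TopologicalSpace A] [TopologicalSpace A'] [Finite A] [Finite A']
  [DiscreteTopology A] [DiscreteTopology A']
  {X : Subshift A ℤ} {X' : Subshift A' ℤ} {x₀ : X.carrier} {x₀' : X'.carrier}

open CategoryTheory in
/-- The finite fibres over a point `x₁` form an inverse system, so base points over `x₁` can be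
chosen compatibly in all Galois factors. -/
lemma exists_compatible_points (hXS : IsSFT X) (hX : IsIrreducible X)
    {r : ConjClass X x₀ → PointedGaloisFactor X x₀} (hr : IsChoice r) (x₁ : X.carrier) :
    ∃ s : ∀ i, (r i).Y.carrier, (∀ i, (r i).ϖ (s i) = x₁) ∧
      ∀ i j α, IsTransition (r i) (r j) α → α (s j) = s i := by
  let _ : Preorder (ConjClass X x₀) :=
    { le := (· ≤ ·)
      le_refl := isPartialOrder_conjClass.refl
      le_trans := isPartialOrder_conjClass.trans }
  have : IsDirectedOrder (ConjClass X x₀) := isDirectedOrder_conjClass hXS hX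
  choose α hα using fun i j (h : i ≤ j) => hr.le_iff.1 h
  let F : (ConjClass X x₀)ᵒᵖ ⥤ Type :=
    { obj := fun i => (r i.unop).ϖ ⁻¹' {x₁}
      map := fun {j i} u => TypeCat.ofHom fun y => ⟨α i.unop j.unop u.unop.le y.1, by
        have := (hα i.unop j.unop u.unop.le).2.2 y.1
        exact this.trans y.2⟩
      map_id := fun i => ConcreteCategory.hom_ext _ _ fun y => Subtype.ext
        (congrFun ((hα i.unop i.unop _).unique (isTransition_id _)) y.1)
      map_comp := fun {k j i} u v => ConcreteCategory.hom_ext _ _ fun y => Subtype.ext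
        (congrFun ((hα i.unop k.unop _).unique
          ((hα i.unop j.unop v.unop.le).comp (hα j.unop k.unop u.unop.le))) y.1) }
  have hfin : ∀ i, Finite (F.obj i) := fun i => (r i.unop).separated.finite_fibre x₁
  have hne : ∀ i, Nonempty (F.obj i) := fun i => by
    obtain ⟨y, hy⟩ := (r i.unop).isGalois.isFactorMap.2.2 x₁
    exact ⟨⟨y, hy⟩⟩
  obtain ⟨s, hs⟩ := nonempty_sections_of_finite_inverse_system F
  refine ⟨fun i => (s (.op i)).1, fun i => (s (.op i)).2, fun i j β hβ => ?_⟩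
  have hij : i ≤ j := hr.le_iff.2 ⟨β, hβ⟩
  rw [hβ.unique (hα i j hij)]
  exact congrArg Subtype.val (hs (homOfLE hij).op)

/-- The Galois factor `f ∘ ϖ` over `X'`, with a new base point. -/
def PointedGaloisFactor.push (P : PointedGaloisFactor X x₀) {f : X.carrier ≃ₜ X'.carrier}
    (hf : ShiftCommuting f) (y : P.Y.carrier) (hy : f (P.ϖ y) = x₀') :
    PointedGaloisFactor X' x₀' where
  alphabetSize := P.alphabetSize
  Y := P.Y
  isSFT := P.isSFT
  isIrreducible := P.isIrreducible
  y₀ := y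
  ϖ z := f (P.ϖ z)
  isGalois := P.isGalois.conj f hf (Homeomorph.refl _) fun _ => rfl
  map_base := hy

/-- The absolute Galois group depends neither on the representatives nor on the base point, and is
invariant under topological conjugacy. Base points over the preimage of `x₀'` are chosen
compatibly in all Galois factors of `X`; with them the Galois factors of `X` become those of `X'`,
with the same transition maps. -/
theorem nonempty_limitGroup_equiv_of_conjugacy (hXS : IsSFT X) (hX : IsIrreducible X)
    {f : X.carrier ≃ₜ X'.carrier} (hf : ShiftCommuting f)
    {r : ConjClass X x₀ → PointedGaloisFactor X x₀} (hr : IsChoice r)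
    {r' : ConjClass X' x₀' → PointedGaloisFactor X' x₀'} (hr' : IsChoice r') :
    Nonempty (limitGroup r ≃ₜ* limitGroup r') := by
  obtain ⟨s, hs, hsα⟩ := exists_compatible_points hXS hX hr (f.symm x₀')
  have hs' : ∀ i, f ((r i).ϖ (s i)) = x₀' := fun i => by rw [hs, f.apply_symm_apply]
  let q : ConjClass X x₀ → PointedGaloisFactor X' x₀' := fun i => (r i).push hf (s i) (hs' i)
  -- a map over `X` that respects the new base points also respects the old ones, because it does
  -- so after composition with a deck transformation, which then has a fixed point
  have hq : ∀ i j (α : (r j).Y.carrier → (r i).Y.carrier),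
      IsTransition (r i) (r j) α ↔ IsTransition (q i) (q j) α := by
    intro i j α
    constructor
    · intro h
      exact isTransition_iff.2 ⟨⟨h.isMapOver.1, h.isMapOver.2.1, fun y =>
        congrArg f (h.2.2 y)⟩, hsα i j α h⟩
    · intro h
      have hα : IsMapOver (r i).ϖ (r j).ϖ α :=
        ⟨h.isMapOver.1, h.isMapOver.2.1, fun y => f.injective (h.2.2 y)⟩
      obtain ⟨φ, hφ, hφy⟩ := (r i).fibreTransitive (α (r j).y₀) (r i).y₀ (by
        rw [hα.2.2, (r j).map_base, (r i).map_base])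
      have h1 : IsTransition (r i) (r j) (φ ∘ α) :=
        isTransition_iff.2 ⟨(isMapOver_of_mem_relAut hφ).comp hα, hφy⟩
      have h2 : φ (α (s j)) = α (s j) := (hsα i j _ h1).trans h.2.1.symm
      have h3 : (⟨φ, hφ⟩ : Gal (r i)) = 1 := gal_ext (y := α (s j)) h2
      have h4 : φ = 1 := congrArg Subtype.val h3
      rw [h4] at hφy
      exact isTransition_iff.2 ⟨hα, hφy⟩
  let e : ConjClass X x₀ → ConjClass X' x₀' := fun i => ConjClass.mk (q i)
  have he : Function.Bijective e := by
    constructor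
    · intro i j hij
      obtain ⟨α, hα⟩ := exists_isTransition_of_mk_eq hij
      obtain ⟨β, hβ⟩ := exists_isTransition_of_mk_eq hij.symm
      rw [← hr i, ← hr j]
      exact mk_eq_mk_of_isTransition ((hq i j α).2 hα) ((hq j i β).2 hβ)
    · intro j
      let P' := r' j
      have hfs := hf.homeomorph_symm
      obtain ⟨y, hy⟩ := P'.isGalois.isFactorMap.2.2 (f x₀)
      let Q : PointedGaloisFactor X x₀ := P'.push hfs y (by rw [hy, f.symm_apply_apply])
      let i := ConjClass.mk Q
      obtain ⟨δ, h1, -, h3⟩ : ∃ δ : (r i).Y.carrier ≃ₜ P'.Y.carrier, ShiftCommuting δ ∧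
          δ (r i).y₀ = y ∧ ∀ z, f.symm (P'.ϖ (δ z)) = (r i).ϖ z :=
        Quotient.exact (hr (ConjClass.mk Q))
      have h3' : ∀ z, P'.ϖ (δ z) = f ((r i).ϖ z) := fun z => by
        rw [← h3 z]
        exact (f.apply_symm_apply _).symm
      obtain ⟨φ, hφ, hφy⟩ := P'.fibreTransitive (δ (s i)) P'.y₀ (by
        rw [h3', hs', P'.map_base])
      refine ⟨i, ?_⟩
      rw [← hr' j]
      exact Quotient.sound ⟨δ.trans φ, (show ShiftCommuting φ from hφ.1).comp h1, hφy,
        fun z => (hφ.2 _).trans (h3' z)⟩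
  have hex : ∀ i, ∃ γ : (r i).Y.carrier ≃ₜ (r' (e i)).Y.carrier,
      ShiftCommuting γ ∧ γ (s i) = (r' (e i)).y₀ ∧ ∀ y, (r' (e i)).ϖ (γ y) = f ((r i).ϖ y) :=
    fun i => Quotient.exact (hr' (e i)).symm
  choose γ hγ hγs hγf using hex
  have hγt : ∀ i, IsTransition (r' (e i)) (q i) (γ i) := fun i =>
    isTransition_of_homeomorph (Q := q i) (hγ i) (hγs i) (hγf i)
  have hγt' : ∀ i, IsTransition (q i) (r' (e i)) (γ i).symm := fun i =>
    isTransition_of_homeomorph (P := q i) (hγ i).homeomorph_symm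
      ((γ i).symm_apply_eq.2 (hγs i).symm) fun y => by
        have := hγf i ((γ i).symm y)
        rw [Homeomorph.apply_symm_apply] at this
        exact this.symm
  exact nonempty_limitGroup_equiv he γ hγ hγf
    (fun i j α h => (hγt i).comp (((hq i j α).1 h).comp (hγt' j)))
    (fun i j α h => (hq i j _).2 ((hγt' i).comp (h.comp (hγt j))))

end invariance

/-! ### The inverse system -/

section system

variable {A : Type} [TopologicalSpace A] [Finite A] [DiscreteTopology A] {X : Subshift A ℤ}
  {x₀ : X.carrier}

lemma IsChoice.existsUnique_isTransition {r : ConjClass X x₀ → PointedGaloisFactor X x₀}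
    (hr : IsChoice r) {i j : ConjClass X x₀} (h : i ≤ j) : ∃! α, IsTransition (r i) (r j) α := by
  obtain ⟨α, hα⟩ := hr.le_iff.1 h
  exact ⟨α, hα, fun β hβ => hβ.unique hα⟩

/-- The homomorphisms `p_ij` of the inverse system of Galois groups. -/
lemma IsChoice.exists_inverse_system {r : ConjClass X x₀ → PointedGaloisFactor X x₀}
    (hr : IsChoice r) :
    ∃ p : ∀ i j, i ≤ j → (Gal (r j) →* Gal (r i)),
      (∀ i j h α, IsTransition (r i) (r j) α → ∀ φ (ψ : Gal (r i)),
        p i j h φ = ψ ↔ ∀ y, ψ.1 (α y) = α (φ.1 y)) ∧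
      (∀ i j h, Function.Surjective (p i j h)) ∧
      (∀ i h φ, p i i h φ = φ) ∧
      (∀ i j k hij hjk hik φ, p i j hij (p j k hjk φ) = p i k hik φ) ∧
      (∀ g : ∀ i, Gal (r i), g ∈ limitGroup r ↔ ∀ i j h, g i = p i j h (g j)) := by
  choose α hα using fun i j (h : i ≤ j) => hr.le_iff.1 h
  refine ⟨fun i j h => (hα i j h).isMapOver.galHom, fun i j h β hβ φ ψ => ?_, fun i j h =>
    IsMapOver.galHom_surjective _, fun i h φ => ?_, fun i j k hij hjk hik φ => ?_, fun g => ?_⟩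
  · rw [hβ.unique (hα i j h)]
    exact IsMapOver.galHom_eq_iff _ _ _
  · rw [IsMapOver.galHom_eq_iff, (hα i i h).unique (isTransition_id _)]
    exact fun _ => rfl
  · refine ((IsMapOver.galHom_eq_iff _ _ _).2 fun y => ?_).symm
    rw [(hα i k hik).unique ((hα i j hij).comp (hα j k hjk))]
    simp only [Function.comp_apply]
    rw [IsMapOver.galHom_apply, IsMapOver.galHom_apply]
  · constructor
    · intro hg i j h
      exact ((IsMapOver.galHom_eq_iff _ _ _).2 (hg i j _ (hα i j h))).symm
    · intro hg i j β hβ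
      have h : i ≤ j := hr.le_iff.2 ⟨β, hβ⟩
      rw [hβ.unique (hα i j h)]
      exact (IsMapOver.galHom_eq_iff (hα i j h).isMapOver _ _).1 (hg i j h).symm

end system

end SFTGalois

theorem theorem1p2 {A : Type} [Finite A] [TopologicalSpace A] [DiscreteTopology A]
    (X : SymbolicDynamics.FullShift.Subshift A ℤ)
    (hX : SFTGalois.IsSFT X) (hXirr : SFTGalois.IsIrreducible X) :
    -- the Galois groups form an inverse system of finite groups over a directed partial order,
    -- and the absolute Galois group is its inverse limit, a profinite group
    (∀ x₀ : X.carrier,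
      IsPartialOrder (SFTGalois.ConjClass X x₀) (· ≤ ·) ∧
      IsDirectedOrder (SFTGalois.ConjClass X x₀) ∧
      Nonempty (SFTGalois.ConjClass X x₀) ∧
      (∀ r : SFTGalois.ConjClass X x₀ → SFTGalois.PointedGaloisFactor X x₀,
        SFTGalois.IsChoice r →
          (∀ i, Finite (SFTGalois.Gal (r i))) ∧
          (∀ i j, i ≤ j → ∃! α, SFTGalois.IsTransition (r i) (r j) α) ∧
          (∃ p : ∀ i j, i ≤ j → (SFTGalois.Gal (r j) →* SFTGalois.Gal (r i)),
            (∀ i j h α, SFTGalois.IsTransition (r i) (r j) α →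
              ∀ φ (ψ : SFTGalois.Gal (r i)),
                p i j h φ = ψ ↔ ∀ y, ψ.1 (α y) = α (φ.1 y)) ∧
            (∀ i j h, Function.Surjective (p i j h)) ∧
            (∀ i h φ, p i i h φ = φ) ∧
            (∀ i j k hij hjk hik φ, p i j hij (p j k hjk φ) = p i k hik φ) ∧
            (∀ g : ∀ i, SFTGalois.Gal (r i),
              g ∈ SFTGalois.limitGroup r ↔ ∀ i j h, g i = p i j h (g j))) ∧
          Nonempty (SFTGalois.limitGroup r ≃ₜ* SFTGalois.AbsGal X x₀)) ∧
      IsTopologicalGroup (SFTGalois.AbsGal X x₀) ∧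
      CompactSpace (SFTGalois.AbsGal X x₀) ∧
      T2Space (SFTGalois.AbsGal X x₀) ∧
      TotallyDisconnectedSpace (SFTGalois.AbsGal X x₀)) ∧
    -- independence of the base point
    (∀ x₀ x₁ : X.carrier, Nonempty (SFTGalois.AbsGal X x₀ ≃ₜ* SFTGalois.AbsGal X x₁)) ∧
    -- the first cohomology is the group of continuous homomorphisms
    (∀ (x₀ : X.carrier) (p : ℕ), p.Prime →
      ∃ e : SFTGalois.H1 p (SFTGalois.AbsGal X x₀) ≃ₗ[ZMod p]
          SFTGalois.HomCont p (SFTGalois.AbsGal X x₀),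
        ∀ σ g, (e ((ContinuousCohomology.π
            (SFTGalois.trivialModule p (SFTGalois.AbsGal X x₀)) 1).hom σ)).1 g =
          SFTGalois.cocycleValue σ g) ∧
    -- conjugacy invariance of the absolute Galois group and of the first cohomology
    (∀ {A' : Type} [Finite A'] [TopologicalSpace A'] [DiscreteTopology A']
      (X' : SymbolicDynamics.FullShift.Subshift A' ℤ),
      SFTGalois.IsSFT X' → SFTGalois.IsIrreducible X' → SFTGalois.Conjugate X X' →
      ∀ (x₀ : X.carrier) (x₀' : X'.carrier),
        Nonempty (SFTGalois.AbsGal X x₀ ≃ₜ* SFTGalois.AbsGal X' x₀') ∧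
        ∀ p : ℕ, p.Prime →
          Nonempty (SFTGalois.H1 p (SFTGalois.AbsGal X x₀) ≃ₗ[ZMod p]
            SFTGalois.H1 p (SFTGalois.AbsGal X' x₀')) ∧
          Nonempty (SFTGalois.HomCont p (SFTGalois.AbsGal X x₀) ≃ₗ[ZMod p]
            SFTGalois.HomCont p (SFTGalois.AbsGal X' x₀'))) := by
  have hiso := fun (x₀ x₁ : X.carrier) {r : SFTGalois.ConjClass X x₀ → _}
      (hr : SFTGalois.IsChoice r) =>
    SFTGalois.nonempty_limitGroup_equiv_of_conjugacy (x₀' := x₁) hX hXirr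
      (f := Homeomorph.refl X.carrier) (fun _ => rfl) hr SFTGalois.isChoice_rep
  refine ⟨fun x₀ => ⟨SFTGalois.isPartialOrder_conjClass,
    SFTGalois.isDirectedOrder_conjClass hX hXirr, SFTGalois.nonempty_conjClass hX hXirr,
    fun r hr => ⟨fun i => (r i).isGalois.finite_relAut,
      fun i j h => hr.existsUnique_isTransition h, hr.exists_inverse_system, hiso x₀ x₀ hr⟩,
    inferInstance, SFTGalois.compactSpace_limitGroup _, inferInstance, inferInstance⟩,
    fun x₀ x₁ => hiso x₀ x₁ SFTGalois.isChoice_rep,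
    fun x₀ p _ => SFTGalois.exists_h1_equiv_homCont, ?_⟩
  rintro A' _ _ _ X' - - ⟨f, hf⟩ x₀ x₀'
  obtain ⟨e⟩ := SFTGalois.nonempty_limitGroup_equiv_of_conjugacy (x₀' := x₀') hX hXirr hf
    (SFTGalois.isChoice_rep (x₀ := x₀)) SFTGalois.isChoice_rep
  refine ⟨⟨e⟩, fun p _ => ?_⟩
  obtain ⟨a, -⟩ := SFTGalois.exists_h1_equiv_homCont (p := p) (G := SFTGalois.AbsGal X x₀)
  obtain ⟨b, -⟩ := SFTGalois.exists_h1_equiv_homCont (p := p) (G := SFTGalois.AbsGal X' x₀')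
  exact ⟨⟨(a.trans (SFTGalois.homContCongr e)).trans b.symm⟩, ⟨SFTGalois.homContCongr e⟩⟩
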